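/- Let $X$ be a separable complex Hilbert space and let $A$, with domain $D(A)\subset X$, be the generator of an exponentially stable $C_0$-semigroup $(T(t))_{t\ge 0}$ on $X$. Let $\mathcal H_\infty^-$ be the algebra of bounded analytic functions on the open left half-plane $\{s\in\mathbb C:\operatorname{Re}s<0\}$, with norm $\|g\|_\infty=\sup_{\operatorname{Re}s<0}|g(s)|$. Then there are constants $\gamma_A,\gamma$, depending only on the semigroup, and a linear map $g\mapsto g(A)$ from $\mathcal H_\infty^-$ to the linear operators $D(A)\to X$ with the following properties. (1) For every $g\in\mathcal H_\infty^-$ the operator $g(A)$ is bounded from $D(A)$, with the graph norm, to $X$, and it is infinite-time admissible: for all $x_0\in D(A)$ one has $g(A)T(\cdot)x_0\in L^2((0,\infty),X)$ and $$\int_0^\infty\|g(A)T(t)x_0\|^2\,dt\le\gamma_A\|g\|_\infty^2\|x_0\|^2 .$$ (2) For every $t>0$ the operator $g(A)T(t):D(A)\to X$ extends to a bounded operator on $X$, again denoted $g(A)T(t)$, and $$\|g(A)T(t)\|\le\frac{\gamma\,\|g\|_\infty}{\sqrt t}.$$ With this extension, the square integrability and the estimate in (1) hold for all $x_0\in X$.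 (3) The map $g\mapsto g(A)$ is a (possibly unbounded) functional calculus: $1(A)x=x$ for all $x\in D(A)$; for every $a\in\mathbb C$ with $\operatorname{Re}a>0$ the operator $aI-A$ is boundedly invertible, and the function $g(s)=1/(a-s)$ gives $g(A)x=(aI-A)^{-1}x$ for all $x\in D(A)$; and for all $g_1,g_2\in\mathcal H_\infty^-$ and $x\in D(A^2)$ one has $g_2(A)x\in D(A)$ and $(g_1g_2)(A)x=g_1(A)\,g_2(A)x$. (4) Let $g(i\,\cdot)$ denote the boundary function of $g$ on the imaginary axis, i.e. $g(i\omega)=\lim_{\varepsilon\downarrow0}g(-\varepsilon+i\omega)$ for almost every $\omega\in\mathbb R$. For every $x_0\in X$, the function $g(A)T(\cdot)x_0$ is the image of $T(\cdot)x_0$ under the Toeplitz operator on $L^2((0,\infty),X)$ with symbol $g$: extend $T(\cdot)x_0$ by zero to $\mathbb R$, multiply its Fourier transform by $g(i\,\cdot)$, apply the inverse Fourier transform, and restrict to $(0,\infty)$. -/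

import Mathlib

open Filter Topology MeasureTheory
open scoped FourierTransform

/-- `T` is a strongly continuous one-parameter semigroup of bounded operators on `X`. Only the
values `T t` with `0 ≤ t` matter. -/
structure IsC0Semigroup {X : Type*} [NormedAddCommGroup X] [NormedSpace ℂ X]
    (T : ℝ → X →L[ℂ] X) : Prop where
  map_zero : T 0 = ContinuousLinearMap.id ℂ X
  map_add : ∀ s t : ℝ, 0 ≤ s → 0 ≤ t → T (s + t) = (T s).comp (T t)
  continuousOn : ∀ x : X, ContinuousOn (fun t : ℝ => T t x) (Set.Ici 0)

/-- Exponential stability: `‖T t‖ ≤ M e^{-ω t}` for all `t ≥ 0`, with some `ω > 0`. -/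
def IsExponentiallyStable {X : Type*} [NormedAddCommGroup X] [NormedSpace ℂ X]
    (T : ℝ → X →L[ℂ] X) : Prop :=
  ∃ M ω : ℝ, 0 < ω ∧ ∀ t : ℝ, 0 ≤ t → ‖T t‖ ≤ M * Real.exp (-ω * t)

/-- `A` is the infinitesimal generator of `T`: `x ∈ D(A)` and `A x = y` if and only if
`(T h x - x) / h → y` as `h ↓ 0`. -/
def IsGenerator {X : Type*} [NormedAddCommGroup X] [NormedSpace ℂ X]
    (A : X →ₗ.[ℂ] X) (T : ℝ → X →L[ℂ] X) : Prop :=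
  ∀ x y : X, (x, y) ∈ A.graph ↔
    Tendsto (fun h : ℝ => (h : ℂ)⁻¹ • (T h x - x)) (𝓝[>] 0) (𝓝 y)

/-- The domain of the generator is invariant under the semigroup. -/
theorem IsGenerator.apply_mem_domain {X : Type*} [NormedAddCommGroup X] [NormedSpace ℂ X]
    {A : X →ₗ.[ℂ] X} {T : ℝ → X →L[ℂ] X} (hA : IsGenerator A T) (hT : IsC0Semigroup T)
    {x : X} (hx : x ∈ A.domain) {t : ℝ} (ht : 0 ≤ t) : T t x ∈ A.domain := by
  have h1 := (hA x (A ⟨x, hx⟩)).1 (A.mem_graph ⟨x, hx⟩)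
  have h2 : Tendsto (fun h : ℝ => (h : ℂ)⁻¹ • (T h (T t x) - T t x)) (𝓝[>] 0)
      (𝓝 (T t (A ⟨x, hx⟩))) := by
    refine (((T t).continuous.tendsto _).comp h1).congr' ?_
    filter_upwards [self_mem_nhdsWithin] with h hh
    have hh' : (0 : ℝ) ≤ h := le_of_lt hh
    have e1 : T h (T t x) = T t (T h x) := by
      rw [← ContinuousLinearMap.comp_apply, ← ContinuousLinearMap.comp_apply,
        ← hT.map_add h t hh' ht, ← hT.map_add t h ht hh', add_comm]
    simp [e1]
  exact LinearPMap.mem_domain_of_mem_graph ((hA _ _).2 h2)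

/-- The open left half-plane. -/
def leftHalfPlane : Set ℂ := {s : ℂ | s.re < 0}

/-- The algebra (under pointwise operations) of bounded analytic functions on the open left
half-plane. -/
def HInfMinus : Subalgebra ℂ (leftHalfPlane → ℂ) where
  carrier := {g | (∃ G : ℂ → ℂ, DifferentiableOn ℂ G leftHalfPlane ∧
      ∀ s : leftHalfPlane, g s = G s) ∧ ∃ C : ℝ, ∀ s : leftHalfPlane, ‖g s‖ ≤ C}
  mul_mem' := by
    rintro f g ⟨⟨F, hF, hfF⟩, C, hC⟩ ⟨⟨G, hG, hgG⟩, D, hD⟩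
    refine ⟨⟨fun s => F s * G s, hF.mul hG, fun s => by simp [hfF, hgG]⟩, C * D, fun s => ?_⟩
    rw [Pi.mul_apply, norm_mul]
    exact mul_le_mul (hC s) (hD s) (norm_nonneg _) ((norm_nonneg _).trans (hC s))
  add_mem' := by
    rintro f g ⟨⟨F, hF, hfF⟩, C, hC⟩ ⟨⟨G, hG, hgG⟩, D, hD⟩
    refine ⟨⟨fun s => F s + G s, hF.add hG, fun s => by simp [hfF, hgG]⟩, C + D, fun s => ?_⟩
    exact (norm_add_le _ _).trans (add_le_add (hC s) (hD s))
  algebraMap_mem' := fun r =>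
    ⟨⟨fun _ => r, differentiableOn_const r, fun _ => rfl⟩, ‖r‖, fun _ => le_rfl⟩

/-- The supremum norm `‖g‖_∞` on the open left half-plane. -/
noncomputable def hInfNorm (g : HInfMinus) : ℝ := ⨆ s : leftHalfPlane, ‖g.1 s‖

/-- The function `s ↦ 1 / (a - s)`, for `Re a > 0`. -/
noncomputable def invSubFun (a : ℂ) (ha : 0 < a.re) : HInfMinus :=
  ⟨fun s => (a - s)⁻¹, by
    have key : ∀ s : ℂ, s ∈ leftHalfPlane → a.re ≤ ‖a - s‖ := fun s hs => by
      have h1 : (a - s).re ≤ ‖a - s‖ := Complex.re_le_norm _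
      have h2 : s.re < 0 := hs
      rw [Complex.sub_re] at h1
      linarith
    refine ⟨⟨fun s => (a - s)⁻¹, ?_, fun _ => rfl⟩, a.re⁻¹, fun s => ?_⟩
    · refine DifferentiableOn.inv (by fun_prop) fun s hs => ?_
      exact norm_pos_iff.1 (lt_of_lt_of_le ha (key s hs))
    · rw [norm_inv]
      exact inv_anti₀ ha (key s s.2)⟩

/-- `b` is the boundary function of `g` on the imaginary axis: for almost every `ω`, `g(s)` tends
to `b(ω)` as `s → iω` horizontally from the left. (By Fatou's theorem every `g` has such a `b`,
unique up to null sets.) -/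
def IsBoundaryFunction (g : HInfMinus) (b : ℝ → ℂ) : Prop :=
  ∀ᵐ ω : ℝ, Tendsto (fun ε : Set.Ioi (0 : ℝ) =>
      g.1 ⟨-(ε : ℝ) + (ω : ℂ) * Complex.I, by
        have h : (0 : ℝ) < ε := ε.2
        simpa [leftHalfPlane] using h⟩)
    (comap Subtype.val (𝓝 0)) (𝓝 (b ω))

/-- `u = M_b f` in `L²((0,∞), X)`, where `M_b` is the Toeplitz operator with symbol `b`: extend `f`
by zero to the line, multiply its Fourier transform by `b`, transform back, and restrict to
`(0,∞)`. With Mathlib's normalization `(𝓕 f)(ξ) = ∫ e^{-2π i t ξ} f(t) dt`, the frequency `ξ`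
belongs to the point `2π i ξ` of the imaginary axis. -/
def IsToeplitzImage {X : Type*} [NormedAddCommGroup X] [InnerProductSpace ℂ X] [CompleteSpace X]
    (b : ℝ → ℂ) (f u : ℝ → X) : Prop :=
  ∃ F G : Lp X 2 (volume : Measure ℝ),
    F =ᵐ[volume] (Set.Ioi (0 : ℝ)).indicator f ∧
    (𝓕 G : Lp X 2 (volume : Measure ℝ)) =ᵐ[volume]
      (fun ξ : ℝ => b (2 * Real.pi * ξ) • (𝓕 F : Lp X 2 (volume : Measure ℝ)) ξ) ∧
    G =ᵐ[volume.restrict (Set.Ioi (0 : ℝ))] u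

/-- The value `C x` of an operator `C : D(A) → X` at `x ∈ D(A)`, and `0` at `x ∉ D(A)`. It is only
used at points of `D(A)`, such as `T t x` with `x ∈ D(A)` and `t ≥ 0`. -/
noncomputable def applyOnDomain {X : Type*} [NormedAddCommGroup X] [NormedSpace ℂ X]
    {A : X →ₗ.[ℂ] X} (C : A.domain →ₗ[ℂ] X) (x : X) : X :=
  open Classical in if h : x ∈ A.domain then C ⟨x, h⟩ else 0

/-- `C : D(A) → X` is bounded with respect to the graph norm of `A`. -/
def IsBoundedOnDomain {X : Type*} [NormedAddCommGroup X] [NormedSpace ℂ X]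
    {A : X →ₗ.[ℂ] X} (C : A.domain →ₗ[ℂ] X) : Prop :=
  ∃ K : ℝ, ∀ x : A.domain, ‖C x‖ ≤ K * (‖(x : X)‖ + ‖A x‖)

/-- `C : D(A) → X` is an (infinite-time) admissible output operator for `T`, with constant `m`:
`C T(·) x ∈ L²((0,∞), X)` and `∫₀^∞ ‖C T(t) x‖² dt ≤ m ‖x‖²` for all `x ∈ D(A)`. -/
def IsAdmissibleWith {X : Type*} [NormedAddCommGroup X] [NormedSpace ℂ X]
    {A : X →ₗ.[ℂ] X} (T : ℝ → X →L[ℂ] X) (C : A.domain →ₗ[ℂ] X) (m : ℝ) : Prop :=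
  ∀ x : A.domain,
    MemLp (fun t : ℝ => applyOnDomain C (T t x)) 2 (volume.restrict (Set.Ioi (0 : ℝ))) ∧
    ∫ t in Set.Ioi (0 : ℝ), ‖applyOnDomain C (T t x)‖ ^ 2 ≤ m * ‖(x : X)‖ ^ 2

/-- `R = (a I - A)⁻¹` is the bounded inverse of `a I - A : D(A) → X`. -/
def IsResolventAt {X : Type*} [NormedAddCommGroup X] [NormedSpace ℂ X]
    (A : X →ₗ.[ℂ] X) (a : ℂ) (R : X →L[ℂ] X) : Prop :=
  (∀ x : X, ∃ h : R x ∈ A.domain, a • R x - A ⟨R x, h⟩ = x) ∧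
  ∀ y : A.domain, R (a • (y : X) - A y) = y

/-- The linear map `g ↦ g(A) = Φ g`, from bounded analytic functions on the left half-plane to
operators `D(A) → X`, is a (possibly unbounded) functional calculus for `A`. -/
structure IsHInfCalculus {X : Type*} [NormedAddCommGroup X] [NormedSpace ℂ X]
    (A : X →ₗ.[ℂ] X) (Φ : HInfMinus →ₗ[ℂ] (A.domain →ₗ[ℂ] X)) : Prop where
  /-- The constant function `1` is mapped to the identity. -/
  map_one : ∀ x : A.domain, Φ 1 x = x
  /-- The function `s ↦ 1 / (a - s)` is mapped to `(a I - A)⁻¹`. -/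
  map_resolvent : ∀ (a : ℂ) (ha : 0 < a.re), ∃ R : X →L[ℂ] X, IsResolventAt A a R ∧
    ∀ x : A.domain, Φ (invSubFun a ha) x = R x
  /-- On `D(A²)`, `(g₁ g₂)(A) = g₁(A) g₂(A)`; in particular `g₂(A)` maps `D(A²)` into `D(A)`. -/
  map_mul : ∀ (g₁ g₂ : HInfMinus) (x : A.domain), A x ∈ A.domain →
    ∃ h : Φ g₂ x ∈ A.domain, Φ (g₁ * g₂) x = Φ g₁ ⟨Φ g₂ x, h⟩

/-
A symbol `k` that decays quadratically has a kernel `h`, its inverse Laplace transform, and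
`k(A) = ∫₀^∞ h(t) T(t) dt` defines a multiplicative calculus. By a contour shift, the orbit map
`t ↦ e^{-ct} k(A) T(t) x` is, for `-ω < c < 0` and `t > 0`, the inverse Fourier transform of
`k(s) (s - A)⁻¹ x` on the line `Re s = c`. Plancherel's theorem therefore bounds its `L²` norm by
`sup |k|` times a constant depending on the semigroup, and since `‖k(A) T(t) x‖` is at most
`M ‖k(A) T(s) x‖` for `s ≤ t`, it also follows that `‖k(A) T(t)‖` is of order `t^{-1/2}`.

A bounded symbol `g` is approximated by the symbols `gₙ(s) = ((n+1)/(n+1-s))² g(s)`, which decay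
quadratically and satisfy the same bound. The operators `gₙ(A) T(t)` and `gₙ(A) (1 - A)⁻¹` are
uniformly bounded and converge on the dense range of `(1 - A)⁻²`, hence strongly. Their limits are
`g(A) T(t)` and `g(A) (1 - A)⁻¹`, the latter of which gives `g(A)` after composition with `1 - A`.
Letting `c → 0` for the symbols `gₙ`, and then `n → ∞`, identifies the orbit map of `g` with the
Toeplitz operator of symbol `g` applied to the orbit.
-/

open Set
open scoped Real

section FourierTransform

variable {V E : Type*} [NormedAddCommGroup V] [InnerProductSpace ℝ V] [FiniteDimensional ℝ V]
  [MeasurableSpace V] [BorelSpace V]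

section Integral

variable [NormedAddCommGroup E] [NormedSpace ℂ E] {f : V → E}

theorem continuous_fourier_of_integrable (hf : Integrable f) : Continuous (𝓕 f) :=
  VectorFourier.fourierIntegral_continuous Real.continuous_fourierChar continuous_inner hf

theorem continuous_fourierInv_of_integrable (hf : Integrable f) : Continuous (𝓕⁻ f) := by
  rw [Real.fourierInv_eq_fourier_comp_neg]
  exact continuous_fourier_of_integrable hf.comp_neg

theorem integral_fourier_smul_eq_integral_smul_fourier [CompleteSpace E] {φ : V → ℂ}
    (hφ : Integrable φ) (hf : Integrable f) : ∫ ξ, 𝓕 φ ξ • f ξ = ∫ x, φ x • 𝓕 f x := by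
  simpa only [flip_innerₗ] using! VectorFourier.integral_fourierIntegral_smul_eq_flip
    (L := innerₗ V) Real.continuous_fourierChar continuous_inner hφ hf

theorem integral_fourierInv_smul_eq_integral_smul_fourierInv [CompleteSpace E] {φ : V → ℂ}
    (hφ : Integrable φ) (hf : Integrable f) : ∫ ξ, 𝓕⁻ φ ξ • f ξ = ∫ x, φ x • 𝓕⁻ f x := by
  calc ∫ ξ, 𝓕⁻ φ ξ • f ξ = ∫ x, φ (-x) • 𝓕 f x := by
        rw [Real.fourierInv_eq_fourier_comp_neg]
        exact integral_fourier_smul_eq_integral_smul_fourier hφ.comp_neg hf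
    _ = ∫ x, φ x • 𝓕⁻ f x := by
        rw [← integral_neg_eq_self]
        simp only [neg_neg, Real.fourierInv_eq_fourier_neg]

theorem fourier_fourierChar_smul (f : V → E) (v ξ : V) :
    𝓕 (fun x => 𝐞 (inner ℝ x v) • f x) ξ = 𝓕 f (ξ - v) := by
  simp only [Real.fourier_eq, smul_smul, ← AddChar.map_add_eq_mul, inner_sub_right, neg_sub]
  simp only [sub_eq_neg_add]

theorem fourierInv_smul_fourier [CompleteSpace E] {φ : V → ℂ} (hφ : Integrable φ)
    (hf : Integrable f) (v : V) :
    𝓕⁻ (fun ξ => φ ξ • 𝓕 f ξ) v = ∫ x, 𝓕 φ (x - v) • f x := by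
  have hmod : Integrable fun ξ => 𝐞 (inner ℝ ξ v) • φ ξ := by
    simpa using (Real.fourierIntegral_convergent_iff (-v)).2 hφ
  calc 𝓕⁻ (fun ξ => φ ξ • 𝓕 f ξ) v = ∫ ξ, (𝐞 (inner ℝ ξ v) • φ ξ) • 𝓕 f ξ := by
        simp only [Real.fourierInv_eq, smul_assoc]
    _ = ∫ x, 𝓕 φ (x - v) • f x := by
        simp only [← integral_fourier_smul_eq_integral_smul_fourier hmod hf,
          fourier_fourierChar_smul]

end Integral

theorem ae_eq_of_integral_schwartzMap_smul_eq [NormedAddCommGroup E] [NormedSpace ℂ E]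
    [CompleteSpace E] {f g : V → E} {μ : Measure V}
    (hf : LocallyIntegrable f μ) (hg : LocallyIntegrable g μ)
    (h : ∀ φ : SchwartzMap V ℂ, ∫ x, φ x • f x ∂μ = ∫ x, φ x • g x ∂μ) : f =ᵐ[μ] g := by
  refine ae_eq_of_integral_contDiff_smul_eq hf hg fun ψ hψ hψc => ?_
  have hc : HasCompactSupport fun x => (ψ x : ℂ) :=
    hψc.comp_left (g := fun r : ℝ => (r : ℂ)) Complex.ofReal_zero
  simpa using! h (hc.toSchwartzMap (Complex.ofRealCLM.contDiff.comp hψ))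

section LTwo

variable [NormedAddCommGroup E] [InnerProductSpace ℂ E] [CompleteSpace E] {f : V → E}

theorem fourier_toLp_ae_eq (hf : Integrable f) (hf₂ : MemLp f 2) :
    (𝓕 (hf₂.toLp f) : Lp E 2 (volume : Measure V)) =ᵐ[volume] 𝓕 f := by
  refine ae_eq_of_integral_schwartzMap_smul_eq ((Lp.memLp _).locallyIntegrable one_le_two)
    (continuous_fourier_of_integrable hf).locallyIntegrable fun φ => ?_
  calc ∫ x, φ x • (𝓕 (hf₂.toLp f) : Lp E 2 (volume : Measure V)) x
      = Lp.toTemperedDistribution (𝓕 (hf₂.toLp f)) φ := by rw [Lp.toTemperedDistribution_apply]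
    _ = ∫ x, (𝓕 φ) x • hf₂.toLp f x := by
        rw [← Lp.fourier_toTemperedDistribution_eq, TemperedDistribution.fourier_apply,
          Lp.toTemperedDistribution_apply]
    _ = ∫ x, 𝓕 (φ : V → ℂ) x • f x := integral_congr_ae <| by
        filter_upwards [hf₂.coeFn_toLp] with x hx
        rw [hx, SchwartzMap.fourier_coe]
    _ = ∫ x, φ x • 𝓕 f x := integral_fourier_smul_eq_integral_smul_fourier φ.integrable hf

theorem fourierInv_toLp_ae_eq (hf : Integrable f) (hf₂ : MemLp f 2) :
    (𝓕⁻ (hf₂.toLp f) : Lp E 2 (volume : Measure V)) =ᵐ[volume] 𝓕⁻ f := by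
  refine ae_eq_of_integral_schwartzMap_smul_eq ((Lp.memLp _).locallyIntegrable one_le_two)
    (continuous_fourierInv_of_integrable hf).locallyIntegrable fun φ => ?_
  calc ∫ x, φ x • (𝓕⁻ (hf₂.toLp f) : Lp E 2 (volume : Measure V)) x
      = Lp.toTemperedDistribution (𝓕⁻ (hf₂.toLp f)) φ := by rw [Lp.toTemperedDistribution_apply]
    _ = ∫ x, (𝓕⁻ φ) x • hf₂.toLp f x := by
        rw [← Lp.fourierInv_toTemperedDistribution_eq, TemperedDistribution.fourierInv_apply,
          Lp.toTemperedDistribution_apply]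
    _ = ∫ x, 𝓕⁻ (φ : V → ℂ) x • f x := integral_congr_ae <| by
        filter_upwards [hf₂.coeFn_toLp] with x hx
        rw [hx, SchwartzMap.fourierInv_coe]
    _ = ∫ x, φ x • 𝓕⁻ f x := integral_fourierInv_smul_eq_integral_smul_fourierInv φ.integrable hf

theorem memLp_two_fourier (hf : Integrable f) (hf₂ : MemLp f 2) : MemLp (𝓕 f) 2 :=
  (Lp.memLp _).ae_eq (fourier_toLp_ae_eq hf hf₂)

theorem eLpNorm_two_fourier (hf : Integrable f) (hf₂ : MemLp f 2) :
    eLpNorm (𝓕 f) 2 volume = eLpNorm f 2 volume := by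
  rw [← eLpNorm_congr_ae (fourier_toLp_ae_eq hf hf₂), ← eLpNorm_congr_ae hf₂.coeFn_toLp,
    ← Lp.enorm_def, ← Lp.enorm_def, ← ofReal_norm, ← ofReal_norm, Lp.norm_fourier_eq]

theorem eLpNorm_two_fourierInv (hf : Integrable f) (hf₂ : MemLp f 2) :
    eLpNorm (𝓕⁻ f) 2 volume = eLpNorm f 2 volume := by
  rw [← eLpNorm_congr_ae (fourierInv_toLp_ae_eq hf hf₂), ← eLpNorm_congr_ae hf₂.coeFn_toLp,
    ← Lp.enorm_def, ← Lp.enorm_def, ← ofReal_norm, ← ofReal_norm, ← Lp.norm_fourier_eq,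
    FourierTransform.fourier_fourierInv_eq]

end LTwo

end FourierTransform

section ExpCut

variable {E : Type*} [NormedAddCommGroup E] [NormedSpace ℂ E] {f : ℝ → E} {c d δ C : ℝ}

/-- The function `e^{-ct} f(t)` on `(0,∞)`, extended by zero to the real line. Its Fourier transform
is the Laplace transform of `f` along the line `Re s = c`. -/
noncomputable def expCut (c : ℝ) (f : ℝ → E) : ℝ → E :=
  (Ioi 0).indicator fun t => Real.exp (-c * t) • f t

/-- The Laplace transform `∫₀^∞ e^{-st} f(t) dt`. -/
noncomputable def laplaceTransform (f : ℝ → E) (s : ℂ) : E :=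
  ∫ t in Ioi (0 : ℝ), Complex.exp (-s * t) • f t

/-- The point `c + 2πiξ` of the line `Re s = c` that belongs to the frequency `ξ` of `𝓕`. -/
noncomputable def vertLine (c ξ : ℝ) : ℂ := c + 2 * π * ξ * Complex.I

@[simp] theorem vertLine_re (c ξ : ℝ) : (vertLine c ξ).re = c := by simp [vertLine]

@[simp] theorem vertLine_im (c ξ : ℝ) : (vertLine c ξ).im = 2 * π * ξ := by simp [vertLine]

@[fun_prop] theorem continuous_vertLine (c : ℝ) : Continuous (vertLine c) := by
  unfold vertLine; fun_prop

theorem expCut_of_pos {t : ℝ} (ht : 0 < t) : expCut c f t = Real.exp (-c * t) • f t :=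
  indicator_of_mem (mem_Ioi.2 ht) _

theorem expCut_of_nonpos {t : ℝ} (ht : t ≤ 0) : expCut c f t = 0 :=
  indicator_of_notMem (notMem_Ioi.2 ht) _

theorem fourier_expCut (c : ℝ) (f : ℝ → E) (ξ : ℝ) :
    𝓕 (expCut c f) ξ = laplaceTransform f (vertLine c ξ) := by
  rw [Real.fourier_real_eq_integral_exp_smul, laplaceTransform,
    ← integral_indicator measurableSet_Ioi]
  congr 1 with t
  rcases le_or_gt t 0 with ht | ht
  · rw [expCut_of_nonpos ht, smul_zero, indicator_of_notMem (notMem_Ioi.2 ht)]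
  · rw [expCut_of_pos ht, indicator_of_mem (mem_Ioi.2 ht), ← Complex.coe_smul, smul_smul,
      Complex.ofReal_exp, ← Complex.exp_add]
    congr 2
    push_cast [vertLine]
    ring

theorem fourierInv_expCut (c : ℝ) (f : ℝ → E) (ξ : ℝ) :
    𝓕⁻ (expCut (-c) f) ξ = laplaceTransform f (-vertLine c ξ) := by
  rw [Real.fourierInv_eq_fourier_neg, fourier_expCut]
  congr 1
  push_cast [vertLine]
  ring

theorem aestronglyMeasurable_of_expCut (h : AEStronglyMeasurable (expCut c f)) :
    AEStronglyMeasurable f (volume.restrict (Ioi 0)) := by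
  have hexp : Continuous fun t : ℝ => Real.exp (c * t) := by fun_prop
  refine (hexp.aestronglyMeasurable.smul h.restrict).congr ?_
  filter_upwards [ae_restrict_mem measurableSet_Ioi] with t ht
  rw [Pi.smul_apply', expCut_of_pos ht, smul_smul, ← Real.exp_add]
  simp

theorem aestronglyMeasurable_expCut (h : AEStronglyMeasurable f (volume.restrict (Ioi 0))) :
    AEStronglyMeasurable (expCut c f) := by
  have hexp : Continuous fun t : ℝ => Real.exp (-c * t) := by fun_prop
  exact (aestronglyMeasurable_indicator_iff measurableSet_Ioi).2 (hexp.aestronglyMeasurable.smul h)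

theorem norm_expCut_anti (hcd : c ≤ d) (f : ℝ → E) (t : ℝ) :
    ‖expCut d f t‖ ≤ ‖expCut c f t‖ := by
  rcases le_or_gt t 0 with ht | ht
  · rw [expCut_of_nonpos ht, expCut_of_nonpos ht]
  · rw [expCut_of_pos ht, expCut_of_pos ht, norm_smul, norm_smul]
    gcongr ?_ * _
    simp only [Real.norm_eq_abs, Real.abs_exp]
    gcongr

theorem integrable_expCut_mono (hcd : c ≤ d) (h : Integrable (expCut c f)) :
    Integrable (expCut d f) :=
  h.mono (aestronglyMeasurable_expCut (aestronglyMeasurable_of_expCut h.1))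
    (Eventually.of_forall (norm_expCut_anti hcd f))

theorem continuousAt_fourier_expCut (hdc : d < c) (h : Integrable (expCut d f)) (ξ : ℝ) :
    ContinuousAt (fun c => 𝓕 (expCut c f) ξ) c := by
  simp only [ContinuousAt, Real.fourier_eq]
  refine tendsto_integral_filter_of_dominated_convergence (fun t => ‖expCut d f t‖) ?_ ?_ h.norm
    (Eventually.of_forall fun t => ?_)
  · filter_upwards [lt_mem_nhds hdc] with c hc
    exact ((Real.fourierIntegral_convergent_iff ξ).2 (integrable_expCut_mono hc.le h)).1
  · filter_upwards [lt_mem_nhds hdc] with c hc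
    refine Eventually.of_forall fun t => ?_
    rw [Circle.norm_smul]
    exact norm_expCut_anti hc.le f t
  · have hcont : Continuous fun c => expCut c f t := by
      rcases le_or_gt t 0 with ht | ht
      · simpa only [expCut_of_nonpos ht] using continuous_const
      · simp only [expCut_of_pos ht]; fun_prop
    exact (hcont.const_smul _).continuousAt

theorem norm_expCut_le (h : ∀ t : ℝ, 0 < t → ‖f t‖ ≤ C * Real.exp (δ * t)) (t : ℝ) :
    ‖expCut c f t‖ ≤ C * ‖expCut (c - δ) (1 : ℝ → ℂ) t‖ := by
  rcases le_or_gt t 0 with ht | ht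
  · simp [expCut_of_nonpos ht]
  · rw [expCut_of_pos ht, expCut_of_pos ht, norm_smul, norm_smul, Real.norm_eq_abs, Real.abs_exp,
      Real.norm_eq_abs, Real.abs_exp, Pi.one_apply, norm_one, mul_one]
    calc Real.exp (-c * t) * ‖f t‖ ≤ Real.exp (-c * t) * (C * Real.exp (δ * t)) := by
          gcongr; exact h t ht
      _ = C * Real.exp (-(c - δ) * t) := by rw [mul_left_comm, ← Real.exp_add]; ring_nf

theorem integrable_expCut_one (hc : 0 < c) : Integrable (expCut c (1 : ℝ → ℂ)) := by
  refine (integrable_indicator_iff measurableSet_Ioi).2 ?_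
  simpa [IntegrableOn] using (exp_neg_integrableOn_Ioi 0 hc).ofReal (𝕜 := ℂ)

theorem memLp_two_expCut_one (hc : 0 < c) : MemLp (expCut c (1 : ℝ → ℂ)) 2 := by
  refine (memLp_two_iff_integrable_sq_norm (integrable_expCut_one hc).1).2 ?_
  refine (integrable_expCut_one (c := 2 * c) (by positivity)).norm.congr
    (Eventually.of_forall fun t => ?_)
  rcases le_or_gt t 0 with ht | ht
  · simp [expCut_of_nonpos ht]
  · simp only [expCut_of_pos ht, norm_smul, Real.norm_eq_abs, Real.abs_exp, Pi.one_apply, norm_one,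
      mul_one, ← Real.exp_nat_mul]
    ring_nf

theorem integrable_expCut_of_norm_le (hδ : δ < c)
    (hm : AEStronglyMeasurable f (volume.restrict (Ioi 0)))
    (h : ∀ t : ℝ, 0 < t → ‖f t‖ ≤ C * Real.exp (δ * t)) : Integrable (expCut c f) :=
  ((integrable_expCut_one (sub_pos.2 hδ)).norm.const_mul C).mono' (aestronglyMeasurable_expCut hm)
    (Eventually.of_forall (norm_expCut_le h))

theorem integrable_expCut_cexp {s : ℂ} (hs : -c < s.re) :
    Integrable (expCut c fun t => Complex.exp (-s * t)) := by
  have hexp : Continuous fun t : ℝ => Complex.exp (-s * t) := by fun_prop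
  refine integrable_expCut_of_norm_le (δ := -s.re) (C := 1) (by linarith)
    hexp.aestronglyMeasurable fun t _ => ?_
  simp [Complex.norm_exp]

theorem integral_norm_expCut_cexp {s : ℂ} (hs : -c < s.re) :
    ∫ t, ‖expCut c (fun t => Complex.exp (-s * t)) t‖ = (c + s.re)⁻¹ := by
  have hnorm : (fun t => ‖expCut c (fun t => Complex.exp (-s * t)) t‖) =
      (Ioi 0).indicator fun t => Real.exp (-(c + s.re) * t) := by
    ext t
    rcases le_or_gt t 0 with ht | ht
    · rw [expCut_of_nonpos ht, norm_zero, indicator_of_notMem (notMem_Ioi.2 ht)]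
    · rw [expCut_of_pos ht, indicator_of_mem (mem_Ioi.2 ht), norm_smul, Real.norm_eq_abs,
        Real.abs_exp, Complex.norm_exp, ← Real.exp_add]
      simp [add_mul, add_comm]
  rw [hnorm, integral_indicator measurableSet_Ioi, integral_exp_mul_Ioi (by linarith), mul_zero,
    Real.exp_zero, neg_div_neg_eq, one_div]

theorem laplaceTransform_cexp {a s : ℂ} (h : 0 < (a + s).re) :
    laplaceTransform (fun t => Complex.exp (-a * t)) s = (a + s)⁻¹ := by
  have hint := integral_exp_mul_complex_Ioi (a := -(a + s)) (neg_neg_of_pos h) 0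
  rw [Complex.ofReal_zero, mul_zero, Complex.exp_zero, neg_div_neg_eq, one_div] at hint
  simp only [← hint, laplaceTransform, smul_eq_mul, ← Complex.exp_add, neg_add_rev, add_mul]

end ExpCut

section Semigroup

variable {X : Type*} [NormedAddCommGroup X] [NormedSpace ℂ X]

/-- A strongly continuous semigroup with the exponential decay `‖T t‖ ≤ M e^{-ωt}`, `ω > 0`; unlike
in `IsExponentiallyStable`, the constants are explicit. -/
structure IsStableSemigroup (T : ℝ → X →L[ℂ] X) (M ω : ℝ) : Prop extends IsC0Semigroup T where
  pos : 0 < ω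
  norm_le : ∀ t : ℝ, 0 ≤ t → ‖T t‖ ≤ M * Real.exp (-ω * t)

theorem IsExponentiallyStable.exists_isStableSemigroup {T : ℝ → X →L[ℂ] X}
    (h : IsExponentiallyStable T) (hT : IsC0Semigroup T) : ∃ M ω, IsStableSemigroup T M ω :=
  let ⟨M, ω, hω, hM⟩ := h
  ⟨M, ω, hT, hω, hM⟩

/-- The operator `x ↦ ∫₀^∞ φ(t) T(t) x dt` of the Phillips calculus. The junk value `0` is taken
when this map is not a bounded operator. -/
noncomputable def phillipsOp (T : ℝ → X →L[ℂ] X) (φ : ℝ → ℂ) : X →L[ℂ] X :=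
  open Classical in
  if h : ∃ L : X →L[ℂ] X, ∀ x, L x = ∫ t in Ioi (0 : ℝ), φ t • T t x then h.choose else 0

/-- The resolvent `(a - A)⁻¹ = ∫₀^∞ e^{-at} T(t) dt` of the generator of `T`. -/
noncomputable def laplaceResolvent (T : ℝ → X →L[ℂ] X) (a : ℂ) : X →L[ℂ] X :=
  phillipsOp T fun t => Complex.exp (-a * t)

namespace IsStableSemigroup

variable {T : ℝ → X →L[ℂ] X} {M ω c : ℝ} {φ : ℝ → ℂ}

theorem nonneg (hT : IsStableSemigroup T M ω) : 0 ≤ M := by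
  simpa using (norm_nonneg _).trans (hT.norm_le 0 le_rfl)

theorem norm_apply_le (hT : IsStableSemigroup T M ω) {t : ℝ} (ht : 0 ≤ t) (x : X) :
    ‖T t x‖ ≤ M * ‖x‖ * Real.exp (-ω * t) :=
  ((T t).le_of_opNorm_le (hT.norm_le t ht) x).trans_eq (mul_right_comm _ _ _)

theorem norm_le_const (hT : IsStableSemigroup T M ω) {t : ℝ} (ht : 0 ≤ t) : ‖T t‖ ≤ M := by
  refine (hT.norm_le t ht).trans (mul_le_of_le_one_right hT.nonneg ?_)
  rw [Real.exp_le_one_iff, neg_mul]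
  exact neg_nonpos.2 (mul_nonneg hT.pos.le ht)

theorem apply_add (hT : IsStableSemigroup T M ω) {s t : ℝ} (hs : 0 ≤ s) (ht : 0 ≤ t) (x : X) :
    T (s + t) x = T s (T t x) := by
  rw [hT.map_add s t hs ht, ContinuousLinearMap.comp_apply]

theorem apply_comm (hT : IsStableSemigroup T M ω) {s t : ℝ} (hs : 0 ≤ s) (ht : 0 ≤ t) (x : X) :
    T s (T t x) = T t (T s x) := by
  rw [← hT.apply_add hs ht, ← hT.apply_add ht hs, add_comm]

theorem aestronglyMeasurable (hT : IsStableSemigroup T M ω) (x : X) :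
    AEStronglyMeasurable (T · x) (volume.restrict (Ioi 0)) :=
  ((hT.continuousOn x).mono Ioi_subset_Ici_self).aestronglyMeasurable measurableSet_Ioi

section Orbit

theorem norm_expCut_le (hT : IsStableSemigroup T M ω) (x : X) (t : ℝ) :
    ‖expCut c (T · x) t‖ ≤ M * ‖x‖ * ‖expCut (c - -ω) (1 : ℝ → ℂ) t‖ :=
  _root_.norm_expCut_le (fun _ ht => hT.norm_apply_le ht.le x) t

theorem integrable_expCut (hT : IsStableSemigroup T M ω) (hc : -ω < c) (x : X) :
    Integrable (expCut c (T · x)) :=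
  integrable_expCut_of_norm_le hc (hT.aestronglyMeasurable x) fun _ ht => hT.norm_apply_le ht.le x

theorem memLp_two_expCut (hT : IsStableSemigroup T M ω) (hc : -ω < c) (x : X) :
    MemLp (expCut c (T · x)) 2 :=
  (memLp_two_expCut_one (sub_pos.2 hc)).of_le_mul (hT.integrable_expCut hc x).1
    (Eventually.of_forall (hT.norm_expCut_le x))

theorem exists_eLpNorm_two_expCut_le (hT : IsStableSemigroup T M ω) (hc : -ω < c) :
    ∃ B : ℝ, 0 ≤ B ∧ ∀ x : X,
      eLpNorm (expCut c (T · x)) 2 volume ≤ ENNReal.ofReal (B * ‖x‖) := by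
  have hw := memLp_two_expCut_one (sub_pos.2 hc)
  refine ⟨M * (eLpNorm (expCut (c - -ω) (1 : ℝ → ℂ)) 2 volume).toReal,
    mul_nonneg hT.nonneg ENNReal.toReal_nonneg, fun x => ?_⟩
  refine (eLpNorm_le_mul_eLpNorm_of_ae_le_mul
    (Eventually.of_forall (hT.norm_expCut_le x)) 2).trans_eq ?_
  rw [mul_right_comm, ENNReal.ofReal_mul (mul_nonneg hT.nonneg (norm_nonneg _)),
    ENNReal.ofReal_toReal hw.2.ne]

end Orbit

section PhillipsOp

theorem norm_smul_apply_le (hT : IsStableSemigroup T M ω) (φ : ℝ → ℂ) {t : ℝ} (ht : 0 < t) (x : X) :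
    ‖φ t • T t x‖ ≤ M * ‖x‖ * ‖expCut ω φ t‖ := by
  rw [norm_smul, expCut_of_pos ht, norm_smul, Real.norm_of_nonneg (Real.exp_nonneg _)]
  calc ‖φ t‖ * ‖T t x‖ ≤ ‖φ t‖ * (M * ‖x‖ * Real.exp (-ω * t)) := by
        gcongr; exact hT.norm_apply_le ht.le x
    _ = _ := by ring

theorem integrableOn_smul_apply (hT : IsStableSemigroup T M ω) (hφ : Integrable (expCut ω φ))
    (x : X) : IntegrableOn (fun t => φ t • T t x) (Ioi 0) := by
  refine (hφ.norm.const_mul (M * ‖x‖)).restrict.mono'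
    ((aestronglyMeasurable_of_expCut hφ.1).smul (hT.aestronglyMeasurable x)) ?_
  filter_upwards [ae_restrict_mem measurableSet_Ioi] with t ht
  exact hT.norm_smul_apply_le φ ht x

theorem norm_integral_smul_apply_le (hT : IsStableSemigroup T M ω)
    (hφ : Integrable (expCut ω φ)) (x : X) :
    ‖∫ t in Ioi (0 : ℝ), φ t • T t x‖ ≤ M * (∫ t, ‖expCut ω φ t‖) * ‖x‖ := by
  rw [← integral_indicator measurableSet_Ioi, mul_right_comm, ← integral_const_mul]
  refine norm_integral_le_of_norm_le (hφ.norm.const_mul (M * ‖x‖))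
    (Eventually.of_forall fun t => ?_)
  rcases le_or_gt t 0 with ht | ht
  · rw [indicator_of_notMem (notMem_Ioi.2 ht), expCut_of_nonpos ht, norm_zero, norm_zero, mul_zero]
  · rw [indicator_of_mem (mem_Ioi.2 ht)]
    exact hT.norm_smul_apply_le φ ht x

theorem phillipsOp_apply (hT : IsStableSemigroup T M ω) (hφ : Integrable (expCut ω φ)) (x : X) :
    phillipsOp T φ x = ∫ t in Ioi (0 : ℝ), φ t • T t x := by
  have hbdd : ∃ L : X →L[ℂ] X, ∀ x, L x = ∫ t in Ioi (0 : ℝ), φ t • T t x := by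
    refine ⟨LinearMap.mkContinuous
      { toFun := fun x => ∫ t in Ioi (0 : ℝ), φ t • T t x
        map_add' := fun x y => ?_
        map_smul' := fun a x => ?_ } _ (hT.norm_integral_smul_apply_le hφ), fun x => rfl⟩
    · simp only [map_add, smul_add]
      exact integral_add (hT.integrableOn_smul_apply hφ x) (hT.integrableOn_smul_apply hφ y)
    · simp only [map_smul, RingHom.id_apply, smul_comm _ a]
      exact integral_smul a _
  rw [phillipsOp, dif_pos hbdd]
  exact hbdd.choose_spec x

theorem map_phillipsOp [CompleteSpace X] (hT : IsStableSemigroup T M ω)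
    (hφ : Integrable (expCut ω φ)) (K : X →L[ℂ] X) (x : X) :
    K (phillipsOp T φ x) = ∫ t in Ioi (0 : ℝ), φ t • K (T t x) := by
  rw [hT.phillipsOp_apply hφ,
    ← ContinuousLinearMap.integral_comp_comm K (hT.integrableOn_smul_apply hφ x)]
  simp only [map_smul]

theorem map_phillipsOp_comm [CompleteSpace X] (hT : IsStableSemigroup T M ω)
    (hφ : Integrable (expCut ω φ)) {K : X →L[ℂ] X}
    (hK : ∀ t : ℝ, 0 ≤ t → ∀ x, K (T t x) = T t (K x)) (x : X) :
    K (phillipsOp T φ x) = phillipsOp T φ (K x) := by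
  rw [hT.map_phillipsOp hφ, hT.phillipsOp_apply hφ]
  exact setIntegral_congr_fun measurableSet_Ioi
    fun t ht => congrArg (φ t • ·) (hK t (le_of_lt ht) x)

theorem phillipsOp_comm [CompleteSpace X] (hT : IsStableSemigroup T M ω)
    (hφ : Integrable (expCut ω φ)) {t : ℝ} (ht : 0 ≤ t) (x : X) :
    phillipsOp T φ (T t x) = T t (phillipsOp T φ x) :=
  (hT.map_phillipsOp_comm hφ (fun _ hs => hT.apply_comm ht hs) x).symm

theorem phillipsOp_apply_shift (hT : IsStableSemigroup T M ω) (hφ : Integrable (expCut ω φ))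
    {h : ℝ} (hh : 0 ≤ h) (x : X) :
    phillipsOp T φ (T h x) = ∫ t in Ioi h, φ (t - h) • T t x := by
  have hsubst := (measurePreserving_add_right (volume : Measure ℝ) h).setIntegral_preimage_emb
    (measurableEmbedding_addRight h) (fun t => φ (t - h) • T t x) (Ioi h)
  rw [preimage_add_const_Ioi, sub_self] at hsubst
  rw [hT.phillipsOp_apply hφ, ← hsubst]
  refine setIntegral_congr_fun measurableSet_Ioi fun t ht => ?_
  simp only [add_sub_cancel_right, hT.apply_add (le_of_lt ht) hh]

end PhillipsOp

section LaplaceResolvent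

variable {a : ℂ}

theorem laplaceResolvent_apply (hT : IsStableSemigroup T M ω) (ha : -ω < a.re) (x : X) :
    laplaceResolvent T a x = laplaceTransform (T · x) a :=
  hT.phillipsOp_apply (integrable_expCut_cexp ha) x

theorem fourier_expCut (hT : IsStableSemigroup T M ω) (hc : -ω < c) (x : X) (ξ : ℝ) :
    𝓕 (expCut c (T · x)) ξ = laplaceResolvent T (vertLine c ξ) x := by
  rw [hT.laplaceResolvent_apply (by simpa using hc), _root_.fourier_expCut]

theorem norm_laplaceResolvent_apply_le (hT : IsStableSemigroup T M ω) (ha : -ω < a.re) (x : X) :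
    ‖laplaceResolvent T a x‖ ≤ M * (ω + a.re)⁻¹ * ‖x‖ := by
  rw [hT.laplaceResolvent_apply ha, ← integral_norm_expCut_cexp ha]
  exact hT.norm_integral_smul_apply_le (integrable_expCut_cexp ha) x

theorem laplaceResolvent_comm [CompleteSpace X] (hT : IsStableSemigroup T M ω) (ha : -ω < a.re)
    {t : ℝ} (ht : 0 ≤ t) (x : X) : laplaceResolvent T a (T t x) = T t (laplaceResolvent T a x) :=
  hT.phillipsOp_comm (integrable_expCut_cexp ha) ht x

theorem laplaceResolvent_apply_shift (hT : IsStableSemigroup T M ω) (ha : -ω < a.re) {h : ℝ}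
    (hh : 0 ≤ h) (x : X) :
    laplaceResolvent T a (T h x) = Complex.exp (a * h) •
      (laplaceResolvent T a x - ∫ t in (0 : ℝ)..h, Complex.exp (-a * t) • T t x) := by
  have hint := hT.integrableOn_smul_apply (integrable_expCut_cexp ha) x
  have htail : laplaceResolvent T a x - ∫ t in (0 : ℝ)..h, Complex.exp (-a * t) • T t x =
      ∫ t in Ioi h, Complex.exp (-a * t) • T t x := by
    rw [hT.laplaceResolvent_apply ha, sub_eq_iff_eq_add', laplaceTransform]
    exact (intervalIntegral.integral_interval_add_Ioi hint
      (hint.mono_set (Ioi_subset_Ioi hh))).symm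
  rw [laplaceResolvent, hT.phillipsOp_apply_shift (integrable_expCut_cexp ha) hh,
    ← laplaceResolvent, htail, ← integral_smul]
  simp only [smul_smul, ← Complex.exp_add]
  congr 1 with t
  congr 2
  push_cast
  ring

theorem tendsto_laplaceResolvent_quotient [CompleteSpace X] (hT : IsStableSemigroup T M ω)
    (ha : -ω < a.re) (x : X) :
    Tendsto (fun h : ℝ => (h : ℂ)⁻¹ • (T h (laplaceResolvent T a x) - laplaceResolvent T a x))
      (𝓝[>] 0) (𝓝 (a • laplaceResolvent T a x - x)) := by
  set f : ℝ → X := fun t => Complex.exp (-a * t) • T t x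
  set R := laplaceResolvent T a x
  have hf : ContinuousOn f (Ici 0) := ContinuousOn.smul (by fun_prop) (hT.continuousOn x)
  have hf0 : f 0 = x := by simp [f, hT.map_zero]
  have hintegral : HasDerivWithinAt (fun h : ℝ => ∫ t in (0 : ℝ)..h, f t) x (Ici 0) 0 := by
    rw [← hf0]
    refine intervalIntegral.integral_hasDerivWithinAt_right (by simp) (s := Ici 0) (t := Ioi 0)
      ⟨Ioi 0, self_mem_nhdsWithin, ?_⟩ ((hf 0 self_mem_Ici).mono Ioi_subset_Ici_self)
    exact (hf.mono Ioi_subset_Ici_self).aestronglyMeasurable measurableSet_Ioi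
  have hexp : HasDerivAt (fun h : ℝ => Complex.exp (a * h)) a 0 := by
    simpa using ((Complex.ofRealCLM.hasDerivAt (x := 0)).const_mul a).cexp
  have hderiv : HasDerivWithinAt
      (fun h : ℝ => Complex.exp (a * h) • (R - ∫ t in (0 : ℝ)..h, f t)) (a • R - x) (Ici 0) 0 := by
    refine (hexp.hasDerivWithinAt.smul (hintegral.const_sub R)).congr_deriv ?_
    simp [sub_eq_neg_add]
  rw [hasDerivWithinAt_iff_tendsto_slope, Ici_sdiff_left] at hderiv
  refine hderiv.congr' ?_
  filter_upwards [self_mem_nhdsWithin] with h hh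
  rw [slope_def_module, ← hT.laplaceResolvent_apply_shift ha (le_of_lt hh),
    hT.laplaceResolvent_comm ha (le_of_lt hh), ← Complex.ofReal_inv, Complex.coe_smul]
  simp [R]

theorem isResolventAt_laplaceResolvent [CompleteSpace X] {A : X →ₗ.[ℂ] X}
    (hT : IsStableSemigroup T M ω) (hA : IsGenerator A T) (ha : -ω < a.re) :
    IsResolventAt A a (laplaceResolvent T a) := by
  refine ⟨fun x => ?_, fun y => ?_⟩
  · obtain ⟨z, hz, hAz⟩ := (LinearPMap.mem_graph_iff A).1
      ((hA _ _).2 (hT.tendsto_laplaceResolvent_quotient ha x))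
    simp only at hz hAz
    refine ⟨hz ▸ z.2, ?_⟩
    rw [show (⟨laplaceResolvent T a x, hz ▸ z.2⟩ : A.domain) = z from Subtype.ext hz.symm, hAz,
      sub_sub_cancel]
  · have hRA : laplaceResolvent T a (A y) = a • laplaceResolvent T a y - y := by
      refine tendsto_nhds_unique ((((laplaceResolvent T a).continuous.tendsto _).comp
        ((hA y (A y)).1 (A.mem_graph y))).congr' ?_) (hT.tendsto_laplaceResolvent_quotient ha _)
      filter_upwards [self_mem_nhdsWithin] with h hh
      simp only [Function.comp_apply, map_smul, map_sub, hT.laplaceResolvent_comm ha (le_of_lt hh)]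
    rw [map_sub, map_smul, hRA, sub_sub_cancel]

theorem smul_laplaceResolvent_eq_integral (hT : IsStableSemigroup T M ω) {r : ℝ} (hr : 0 < r)
    (x : X) : (r : ℂ) • laplaceResolvent T r x =
      ∫ u in Ioi (0 : ℝ), Real.exp (-u) • T (u / r) x := by
  have hsubst := integral_comp_mul_left_Ioi (fun u : ℝ => Real.exp (-u) • T (u / r) x) 0 hr
  rw [mul_zero, eq_inv_smul_iff₀ hr.ne'] at hsubst
  rw [hT.laplaceResolvent_apply (by simpa using by linarith [hT.pos]), ← hsubst, Complex.coe_smul,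
    laplaceTransform]
  congr 2 with t
  rw [mul_div_cancel_left₀ _ hr.ne', ← Complex.coe_smul]
  push_cast
  rw [neg_mul]

theorem tendsto_smul_laplaceResolvent [CompleteSpace X] (hT : IsStableSemigroup T M ω) (x : X) :
    Tendsto (fun r : ℝ => (r : ℂ) • laplaceResolvent T r x) atTop (𝓝 x) := by
  have hx : ∫ u in Ioi (0 : ℝ), Real.exp (-u) • x = x := by
    rw [integral_smul_const, integral_exp_neg_Ioi_zero, one_smul]
  suffices h : Tendsto (fun r : ℝ => ∫ u in Ioi (0 : ℝ), Real.exp (-u) • T (u / r) x) atTop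
      (𝓝 (∫ u in Ioi (0 : ℝ), Real.exp (-u) • x)) by
    rw [hx] at h
    refine h.congr' ?_
    filter_upwards [eventually_gt_atTop 0] with r hr
    exact (hT.smul_laplaceResolvent_eq_integral hr x).symm
  refine tendsto_integral_filter_of_dominated_convergence (fun u => Real.exp (-u) * (M * ‖x‖))
    ?_ ?_ ?_ ?_
  · filter_upwards [eventually_gt_atTop 0] with r hr
    have hexp : Continuous fun u : ℝ => Real.exp (-u) := by fun_prop
    exact (hexp.continuousOn.smul ((hT.continuousOn x).comp (by fun_prop)
      fun u hu => div_nonneg (le_of_lt hu) hr.le)).aestronglyMeasurable measurableSet_Ioi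
  · filter_upwards [eventually_gt_atTop 0] with r hr
    filter_upwards [ae_restrict_mem measurableSet_Ioi] with u hu
    rw [norm_smul, Real.norm_of_nonneg (Real.exp_nonneg _)]
    gcongr
    exact (T _).le_of_opNorm_le (hT.norm_le_const (div_nonneg (le_of_lt hu) hr.le)) x
  · exact (integrableOn_exp_neg_Ioi 0).mul_const _
  · filter_upwards [ae_restrict_mem measurableSet_Ioi] with u hu
    have hzero : Tendsto (fun r : ℝ => u / r) atTop (𝓝[Ici 0] 0) := by
      refine tendsto_nhdsWithin_iff.2 ⟨tendsto_const_nhds.div_atTop tendsto_id, ?_⟩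
      filter_upwards [eventually_gt_atTop 0] with r hr
      exact div_nonneg (le_of_lt hu) hr.le
    simpa [hT.map_zero] using
      ((hT.continuousOn x 0 self_mem_Ici).tendsto.comp hzero).const_smul (Real.exp (-u))

theorem denseRange_laplaceResolvent [CompleteSpace X] {A : X →ₗ.[ℂ] X}
    (hT : IsStableSemigroup T M ω) (hA : IsGenerator A T) (ha : -ω < a.re) :
    DenseRange (laplaceResolvent T a) := by
  intro x
  refine mem_closure_of_tendsto (hT.tendsto_smul_laplaceResolvent x) ?_
  filter_upwards [eventually_ge_atTop 0] with r hr
  have hr' : -ω < (r : ℂ).re := by simpa using by linarith [hT.pos]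
  obtain ⟨hmem, -⟩ := (hT.isResolventAt_laplaceResolvent hA hr').1 x
  refine ⟨(r : ℂ) • (a • laplaceResolvent T r x - A ⟨_, hmem⟩), ?_⟩
  rw [map_smul, (hT.isResolventAt_laplaceResolvent hA ha).2 ⟨_, hmem⟩]

end LaplaceResolvent

end IsStableSemigroup

end Semigroup

section ContourShift

variable {E : Type*} [NormedAddCommGroup E] {F : ℂ → E} {c c₁ c₂ D : ℝ}

theorem integrable_inv_one_add_two_pi_mul_sq :
    Integrable fun ξ : ℝ => (1 + (2 * π * ξ) ^ 2)⁻¹ :=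
  integrable_inv_one_add_sq.comp_mul_left' Real.two_pi_pos.ne'

theorem integral_inv_one_add_two_pi_mul_sq : ∫ ξ : ℝ, (1 + (2 * π * ξ) ^ 2)⁻¹ = 1 / 2 := by
  rw [Measure.integral_comp_mul_left (fun y : ℝ => (1 + y ^ 2)⁻¹), integral_univ_inv_one_add_sq,
    abs_of_pos (inv_pos.2 Real.two_pi_pos), smul_eq_mul]
  field_simp [Real.pi_ne_zero]

theorem integrable_vertical_of_norm_le (hF : ContinuousOn F {s | s.re = c})
    (hD : ∀ s : ℂ, s.re = c → ‖F s‖ ≤ D * (1 + s.im ^ 2)⁻¹) :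
    Integrable fun y : ℝ => F (c + y * Complex.I) := by
  have hcont : Continuous fun y : ℝ => F (c + y * Complex.I) :=
    hF.comp_continuous (by fun_prop) fun y => by simp
  refine (integrable_inv_one_add_sq.const_mul D).mono' hcont.aestronglyMeasurable
    (Eventually.of_forall fun y => ?_)
  simpa using hD (c + y * Complex.I) (by simp)

variable [NormedSpace ℂ E]

theorem tendsto_horizontal_integral_cocompact (h12 : c₁ ≤ c₂)
    (hD : ∀ s : ℂ, s.re ∈ Icc c₁ c₂ → ‖F s‖ ≤ D * (1 + s.im ^ 2)⁻¹) :
    Tendsto (fun y : ℝ => ∫ x : ℝ in c₁..c₂, F (x + y * Complex.I)) (cocompact ℝ) (𝓝 0) := by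
  have hbound : ∀ y : ℝ, ‖∫ x : ℝ in c₁..c₂, F (x + y * Complex.I)‖ ≤
      D * (1 + ‖y‖ ^ 2)⁻¹ * |c₂ - c₁| := fun y => by
    refine intervalIntegral.norm_integral_le_of_norm_le_const fun x hx => ?_
    rw [uIoc_of_le h12] at hx
    simpa using hD (x + y * Complex.I) (by simpa using Ioc_subset_Icc_self hx)
  have hdecay : Tendsto (fun y : ℝ => (1 + ‖y‖ ^ 2)⁻¹) (cocompact ℝ) (𝓝 0) :=
    tendsto_inv_atTop_zero.comp (tendsto_atTop_add_const_left _ _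
      ((tendsto_pow_atTop two_ne_zero).comp (tendsto_norm_cocompact_atTop)))
  refine squeeze_zero_norm hbound ?_
  simpa using (hdecay.const_mul D).mul_const |c₂ - c₁|

theorem integral_vertical_eq_of_differentiableOn (h12 : c₁ ≤ c₂)
    (hF : DifferentiableOn ℂ F (Complex.re ⁻¹' Icc c₁ c₂))
    (hD : ∀ s : ℂ, s.re ∈ Icc c₁ c₂ → ‖F s‖ ≤ D * (1 + s.im ^ 2)⁻¹) :
    ∫ y : ℝ, F (c₁ + y * Complex.I) = ∫ y : ℝ, F (c₂ + y * Complex.I) := by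
  have hvert : ∀ c ∈ Icc c₁ c₂, Tendsto (fun R : ℝ => ∫ y : ℝ in -R..R, F (c + y * Complex.I))
      atTop (𝓝 (∫ y : ℝ, F (c + y * Complex.I))) := fun c hc =>
    intervalIntegral_tendsto_integral (integrable_vertical_of_norm_le
      (hF.continuousOn.mono fun s (hs : s.re = c) => (hs ▸ hc : s.re ∈ Icc c₁ c₂))
      fun s hs => hD s (hs ▸ hc))
      tendsto_neg_atTop_atBot tendsto_id
  have hhor := tendsto_horizontal_integral_cocompact h12 hD
  have hrect : ∀ R : ℝ, (∫ x : ℝ in c₁..c₂, F (x + ((-R : ℝ) : ℂ) * Complex.I))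
      - (∫ x : ℝ in c₁..c₂, F (x + (R : ℂ) * Complex.I))
      + Complex.I • (∫ y : ℝ in -R..R, F (c₂ + y * Complex.I))
      - Complex.I • (∫ y : ℝ in -R..R, F (c₁ + y * Complex.I)) = 0 := fun R => by
    simpa using Complex.integral_boundary_rect_eq_zero_of_differentiableOn F
      (⟨c₁, -R⟩ : ℂ) (⟨c₂, R⟩ : ℂ) (hF.mono fun s hs => uIcc_of_le h12 ▸ hs.1)
  have hlim := (((hhor.comp (tendsto_neg_atTop_atBot.mono_right atBot_le_cocompact)).sub
    (hhor.comp atTop_le_cocompact)).add ((hvert c₂ (right_mem_Icc.2 h12)).const_smul Complex.I)).sub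
      ((hvert c₁ (left_mem_Icc.2 h12)).const_smul Complex.I)
  have hzero := tendsto_nhds_unique (hlim.congr hrect) tendsto_const_nhds
  rw [sub_zero, zero_add, ← smul_sub, smul_eq_zero_iff_right Complex.I_ne_zero] at hzero
  exact (sub_eq_zero.1 hzero).symm

theorem integral_vertLine (F : ℂ → E) (c : ℝ) :
    ∫ ξ : ℝ, F (vertLine c ξ) = |(2 * π)⁻¹| • ∫ y : ℝ, F (c + y * Complex.I) := by
  rw [← Measure.integral_comp_mul_left (fun y : ℝ => F (c + y * Complex.I))]
  simp [vertLine]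

theorem integral_vertLine_eq_of_differentiableOn (h12 : c₁ ≤ c₂)
    (hF : DifferentiableOn ℂ F (Complex.re ⁻¹' Icc c₁ c₂))
    (hD : ∀ s : ℂ, s.re ∈ Icc c₁ c₂ → ‖F s‖ ≤ D * (1 + s.im ^ 2)⁻¹) :
    ∫ ξ : ℝ, F (vertLine c₁ ξ) = ∫ ξ : ℝ, F (vertLine c₂ ξ) := by
  rw [integral_vertLine, integral_vertLine, integral_vertical_eq_of_differentiableOn h12 hF hD]

end ContourShift

section Kernel

/-- Bounded holomorphic functions on the left half-plane, with the bound `m`; unlike in `HInfMinus`,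
they are defined on the whole plane, so that their values off the half-plane are arbitrary. -/
structure IsBoundedHolo (g : ℂ → ℂ) (m : ℝ) : Prop where
  differentiableOn : DifferentiableOn ℂ g leftHalfPlane
  norm_le : ∀ s : ℂ, s.re < 0 → ‖g s‖ ≤ m

namespace IsBoundedHolo

variable {g g₁ g₂ : ℂ → ℂ} {m m₁ m₂ : ℝ}

theorem nonneg (hg : IsBoundedHolo g m) : 0 ≤ m :=
  (norm_nonneg _).trans (hg.norm_le (-1) (by simp))

theorem mul (h₁ : IsBoundedHolo g₁ m₁) (h₂ : IsBoundedHolo g₂ m₂) :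
    IsBoundedHolo (fun s => g₁ s * g₂ s) (m₁ * m₂) where
  differentiableOn := h₁.differentiableOn.mul h₂.differentiableOn
  norm_le s hs := by
    rw [norm_mul]
    exact mul_le_mul (h₁.norm_le s hs) (h₂.norm_le s hs) (norm_nonneg _) h₁.nonneg

end IsBoundedHolo

/-- Holomorphic functions on the left half-plane that decay quadratically along vertical lines. -/
structure IsDecaying (k : ℂ → ℂ) (C : ℝ) : Prop where
  differentiableOn : DifferentiableOn ℂ k leftHalfPlane
  norm_le : ∀ s : ℂ, s.re < 0 → ‖k s‖ ≤ C * (1 + s.im ^ 2)⁻¹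

/-- The inverse Laplace transform of `s ↦ k (-s)`, written as an integral over the line
`Re s = -1`. -/
noncomputable def kernel (k : ℂ → ℂ) (t : ℝ) : ℂ :=
  ∫ ξ : ℝ, k (vertLine (-1) ξ) * Complex.exp (-vertLine (-1) ξ * t)

theorem kernel_congr {k₁ k₂ : ℂ → ℂ} (h : ∀ s : ℂ, s.re < 0 → k₁ s = k₂ s) :
    kernel k₁ = kernel k₂ := by
  ext t
  simp only [kernel, h _ (show (vertLine (-1) _).re < 0 by simp)]

theorem kernel_const_mul (a : ℂ) (k : ℂ → ℂ) (t : ℝ) :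
    kernel (fun s => a * k s) t = a * kernel k t := by
  simp only [kernel, mul_assoc, integral_const_mul]

theorem norm_cexp_neg_vertLine_mul (c ξ t : ℝ) :
    ‖Complex.exp (-vertLine c ξ * t)‖ = Real.exp (-c * t) := by
  simp [Complex.norm_exp]

namespace IsDecaying

variable {k k₁ k₂ : ℂ → ℂ} {C C₁ C₂ c : ℝ}

theorem nonneg (hk : IsDecaying k C) : 0 ≤ C := by
  simpa using (norm_nonneg _).trans (hk.norm_le (-1) (by simp))

theorem continuous_vertLine (hk : IsDecaying k C) (hc : c < 0) :
    Continuous fun ξ => k (vertLine c ξ) :=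
  hk.differentiableOn.continuousOn.comp_continuous (by fun_prop) fun ξ => by
    simpa [leftHalfPlane] using hc

theorem norm_vertLine_le (hk : IsDecaying k C) (hc : c < 0) (ξ : ℝ) :
    ‖k (vertLine c ξ)‖ ≤ C * (1 + (2 * π * ξ) ^ 2)⁻¹ := by
  simpa using hk.norm_le (vertLine c ξ) (by simpa using hc)

theorem integrable_vertLine (hk : IsDecaying k C) (hc : c < 0) :
    Integrable fun ξ => k (vertLine c ξ) :=
  (integrable_inv_one_add_two_pi_mul_sq.const_mul C).mono'
    (hk.continuous_vertLine hc).aestronglyMeasurable (Eventually.of_forall (hk.norm_vertLine_le hc))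

theorem integral_vertLine_mul_cexp_eq (hk : IsDecaying k C) {c₁ c₂ : ℝ} (h12 : c₁ ≤ c₂)
    (h2 : c₂ < 0) (t : ℝ) :
    ∫ ξ : ℝ, k (vertLine c₁ ξ) * Complex.exp (-vertLine c₁ ξ * t) =
      ∫ ξ : ℝ, k (vertLine c₂ ξ) * Complex.exp (-vertLine c₂ ξ * t) := by
  refine integral_vertLine_eq_of_differentiableOn (F := fun s => k s * Complex.exp (-s * t))
    (D := C * max (Real.exp (-c₁ * t)) (Real.exp (-c₂ * t))) h12 ?_ fun s hs => ?_
  · exact (hk.differentiableOn.mono fun s hs => lt_of_le_of_lt hs.2 h2).mul (by fun_prop)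
  · have hexp : Real.exp (-s.re * t) ≤ max (Real.exp (-c₁ * t)) (Real.exp (-c₂ * t)) := by
      rcases le_total 0 t with ht | ht
      · exact le_max_of_le_left (Real.exp_le_exp.2
          (mul_le_mul_of_nonneg_right (neg_le_neg hs.1) ht))
      · exact le_max_of_le_right (Real.exp_le_exp.2
          (mul_le_mul_of_nonpos_right (neg_le_neg hs.2) ht))
    calc ‖k s * Complex.exp (-s * t)‖ = ‖k s‖ * Real.exp (-s.re * t) := by
          simp [Complex.norm_exp]
      _ ≤ C * (1 + s.im ^ 2)⁻¹ * max (Real.exp (-c₁ * t)) (Real.exp (-c₂ * t)) :=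
          mul_le_mul (hk.norm_le s (lt_of_le_of_lt hs.2 h2)) hexp (Real.exp_nonneg _)
            (mul_nonneg hk.nonneg (by positivity))
      _ = _ := mul_right_comm _ _ _

theorem kernel_eq (hk : IsDecaying k C) (hc : c < 0) (t : ℝ) :
    kernel k t = ∫ ξ : ℝ, k (vertLine c ξ) * Complex.exp (-vertLine c ξ * t) := by
  rcases le_total (-1) c with h | h
  · exact hk.integral_vertLine_mul_cexp_eq h hc t
  · exact (hk.integral_vertLine_mul_cexp_eq h (by norm_num) t).symm

theorem fourier_vertLine (hk : IsDecaying k C) (hc : c < 0) (t : ℝ) :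
    𝓕 (fun ξ => k (vertLine c ξ)) t = Real.exp (c * t) • kernel k t := by
  rw [hk.kernel_eq hc, Real.fourier_real_eq_integral_exp_smul, ← integral_smul]
  congr 1 with ξ
  rw [smul_eq_mul, ← Complex.coe_smul, smul_eq_mul, mul_left_comm, Complex.ofReal_exp,
    ← Complex.exp_add, mul_comm]
  congr 2
  push_cast [vertLine]
  ring

theorem continuous_kernel (hk : IsDecaying k C) : Continuous (kernel k) := by
  have hkernel : kernel k = fun t : ℝ => Real.exp t • 𝓕 (fun ξ => k (vertLine (-1) ξ)) t := by
    ext t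
    rw [hk.fourier_vertLine (by norm_num), smul_smul, ← Real.exp_add]
    simp
  rw [hkernel]
  exact Real.continuous_exp.smul
    (continuous_fourier_of_integrable (hk.integrable_vertLine (by norm_num)))

theorem norm_kernel_le_exp (hk : IsDecaying k C) (hc : c < 0) (t : ℝ) :
    ‖kernel k t‖ ≤ C / 2 * Real.exp (-c * t) := by
  rw [hk.kernel_eq hc, ← mul_one_div, ← integral_inv_one_add_two_pi_mul_sq, ← integral_const_mul,
    ← integral_mul_const]
  refine norm_integral_le_of_norm_le
    ((integrable_inv_one_add_two_pi_mul_sq.const_mul C).mul_const _)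
    (Eventually.of_forall fun ξ => ?_)
  rw [norm_mul, norm_cexp_neg_vertLine_mul]
  exact mul_le_mul_of_nonneg_right (hk.norm_vertLine_le hc ξ) (Real.exp_nonneg _)

theorem norm_kernel_le (hk : IsDecaying k C) (t : ℝ) : ‖kernel k t‖ ≤ C / 2 := by
  have hlim : Tendsto (fun c : ℝ => C / 2 * Real.exp (-c * t)) (𝓝[<] 0)
      (𝓝 (C / 2 * Real.exp (-0 * t))) :=
    (Continuous.tendsto (by fun_prop) 0).mono_left nhdsWithin_le_nhds
  rw [neg_zero, zero_mul, Real.exp_zero, mul_one] at hlim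
  exact ge_of_tendsto hlim (eventually_mem_nhdsWithin.mono fun c hc => hk.norm_kernel_le_exp hc t)

-- Moving the line of integration to `Re s = -∞` annihilates the kernel on the negative half-line.
theorem kernel_of_nonpos (hk : IsDecaying k C) {t : ℝ} (ht : t ≤ 0) : kernel k t = 0 := by
  have hneg : EqOn (kernel k) (fun _ => 0) (Iio 0) := by
    intro t ht
    have hlim : Tendsto (fun c : ℝ => C / 2 * Real.exp (-c * t)) atBot (𝓝 (C / 2 * 0)) := by
      refine (Real.tendsto_exp_atBot.comp ?_).const_mul _
      simpa only [neg_mul_comm, id] using tendsto_id.atBot_mul_const (neg_pos.2 (mem_Iio.1 ht))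
    rw [mul_zero] at hlim
    refine norm_le_zero_iff.1 (ge_of_tendsto hlim ?_)
    filter_upwards [eventually_lt_atBot (0 : ℝ)] with c hc
    exact hk.norm_kernel_le_exp hc t
  have hclosure := hneg.closure hk.continuous_kernel continuous_const
  rw [closure_Iio] at hclosure
  exact hclosure ht

theorem integrable_expCut_kernel (hk : IsDecaying k C) (hc : 0 < c) :
    Integrable (expCut c (kernel k)) :=
  integrable_expCut_of_norm_le (δ := 0) (C := C / 2) hc
    hk.continuous_kernel.aestronglyMeasurable fun t _ => by simpa using hk.norm_kernel_le t

theorem fourier_vertLine_eq_expCut (hk : IsDecaying k C) (hc : c < 0) :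
    𝓕 (fun ξ => k (vertLine c ξ)) = expCut (-c) (kernel k) := by
  ext t
  rw [hk.fourier_vertLine hc]
  rcases le_or_gt t 0 with ht | ht
  · rw [expCut_of_nonpos ht, hk.kernel_of_nonpos ht, smul_zero]
  · rw [expCut_of_pos ht, neg_neg]

theorem laplaceTransform_kernel (hk : IsDecaying k C) (hc : c < 0) (ξ : ℝ) :
    laplaceTransform (kernel k) (-vertLine c ξ) = k (vertLine c ξ) := by
  rw [← fourierInv_expCut, ← hk.fourier_vertLine_eq_expCut hc]
  refine congrFun ((hk.continuous_vertLine hc).fourierInv_fourier_eq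
    (hk.integrable_vertLine hc) ?_) ξ
  rw [hk.fourier_vertLine_eq_expCut hc]
  exact hk.integrable_expCut_kernel (neg_pos.2 hc)

theorem add (h₁ : IsDecaying k₁ C₁) (h₂ : IsDecaying k₂ C₂) :
    IsDecaying (fun s => k₁ s + k₂ s) (C₁ + C₂) where
  differentiableOn := h₁.differentiableOn.add h₂.differentiableOn
  norm_le s hs := by
    rw [add_mul]
    exact (norm_add_le _ _).trans (add_le_add (h₁.norm_le s hs) (h₂.norm_le s hs))

theorem isBoundedHolo (hk : IsDecaying k C) : IsBoundedHolo k C where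
  differentiableOn := hk.differentiableOn
  norm_le s hs := (hk.norm_le s hs).trans (mul_le_of_le_one_right hk.nonneg
    (inv_le_one_of_one_le₀ (le_add_of_nonneg_right (sq_nonneg _))))

theorem bounded_mul (hk : IsDecaying k C) {g : ℂ → ℂ} {m : ℝ} (hg : IsBoundedHolo g m) :
    IsDecaying (fun s => g s * k s) (m * C) where
  differentiableOn := hg.differentiableOn.mul hk.differentiableOn
  norm_le s hs := by
    rw [norm_mul, mul_assoc]
    exact mul_le_mul (hg.norm_le s hs) (hk.norm_le s hs) (norm_nonneg _) hg.nonneg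

theorem const_mul (hk : IsDecaying k C) (a : ℂ) : IsDecaying (fun s => a * k s) (‖a‖ * C) :=
  hk.bounded_mul ⟨differentiableOn_const a, fun _ _ => le_rfl⟩

theorem mul (h₁ : IsDecaying k₁ C₁) (h₂ : IsDecaying k₂ C₂) :
    IsDecaying (fun s => k₁ s * k₂ s) (C₁ * C₂) :=
  h₂.bounded_mul h₁.isBoundedHolo

theorem kernel_add (h₁ : IsDecaying k₁ C₁) (h₂ : IsDecaying k₂ C₂) (t : ℝ) :
    kernel (fun s => k₁ s + k₂ s) t = kernel k₁ t + kernel k₂ t := by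
  have hint : ∀ {k C}, IsDecaying k C → Integrable fun ξ : ℝ =>
      k (vertLine (-1) ξ) * Complex.exp (-vertLine (-1) ξ * t) := fun hk =>
    (hk.integrable_vertLine (by norm_num)).mul_bdd (c := Real.exp (-(-1) * t))
      (Continuous.aestronglyMeasurable (by fun_prop))
      (Eventually.of_forall fun ξ => (norm_cexp_neg_vertLine_mul _ _ _).le)
  simp only [kernel, add_mul]
  exact integral_add (hint h₁) (hint h₂)

end IsDecaying

end Kernel

section Calculus

/-- The operator `k(A) = ∫₀^∞ h(t) T(t) dt`, where `h` is the kernel of `k`. -/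
noncomputable def decayCalc {X : Type*} [NormedAddCommGroup X] [NormedSpace ℂ X]
    (T : ℝ → X →L[ℂ] X) (k : ℂ → ℂ) : X →L[ℂ] X := phillipsOp T (kernel k)

/-- The function `k(s) (s - A)⁻¹ x` on the line `Re s = c`, in terms of the frequency. -/
noncomputable def lineSymbol {X : Type*} [NormedAddCommGroup X] [NormedSpace ℂ X]
    (T : ℝ → X →L[ℂ] X) (k : ℂ → ℂ) (c : ℝ) (x : X) (ξ : ℝ) : X :=
  k (vertLine c ξ) • 𝓕 (expCut c (T · x)) ξ

theorem decayCalc_congr {X : Type*} [NormedAddCommGroup X] [NormedSpace ℂ X]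
    (T : ℝ → X →L[ℂ] X) {k₁ k₂ : ℂ → ℂ} (h : ∀ s : ℂ, s.re < 0 → k₁ s = k₂ s) :
    decayCalc T k₁ = decayCalc T k₂ := by
  rw [decayCalc, decayCalc, kernel_congr h]

theorem norm_lineSymbol_le {X : Type*} [NormedAddCommGroup X] [NormedSpace ℂ X]
    {T : ℝ → X →L[ℂ] X} {k : ℂ → ℂ} {c m : ℝ} (hm : ∀ s : ℂ, s.re < 0 → ‖k s‖ ≤ m)
    (hc : c < 0) (x : X) (ξ : ℝ) :
    ‖lineSymbol T k c x ξ‖ ≤ m * ‖𝓕 (expCut c (T · x)) ξ‖ := by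
  rw [lineSymbol, norm_smul]
  exact mul_le_mul_of_nonneg_right (hm _ (by simpa using hc)) (norm_nonneg _)

namespace IsStableSemigroup

variable {X : Type*} [NormedAddCommGroup X] [NormedSpace ℂ X]
  {T : ℝ → X →L[ℂ] X} {M ω c : ℝ} {k k₁ k₂ : ℂ → ℂ} {C C₁ C₂ : ℝ}

theorem decayCalc_apply (hT : IsStableSemigroup T M ω) (hk : IsDecaying k C) (x : X) :
    decayCalc T k x = ∫ t in Ioi (0 : ℝ), kernel k t • T t x :=
  hT.phillipsOp_apply (hk.integrable_expCut_kernel hT.pos) x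

theorem decayCalc_add (hT : IsStableSemigroup T M ω) (h₁ : IsDecaying k₁ C₁)
    (h₂ : IsDecaying k₂ C₂) (x : X) :
    decayCalc T (fun s => k₁ s + k₂ s) x = decayCalc T k₁ x + decayCalc T k₂ x := by
  rw [hT.decayCalc_apply (h₁.add h₂), hT.decayCalc_apply h₁, hT.decayCalc_apply h₂,
    ← integral_add (hT.integrableOn_smul_apply (h₁.integrable_expCut_kernel hT.pos) x)
      (hT.integrableOn_smul_apply (h₂.integrable_expCut_kernel hT.pos) x)]
  simp only [h₁.kernel_add h₂, add_smul]

theorem decayCalc_const_mul (hT : IsStableSemigroup T M ω) (hk : IsDecaying k C) (a : ℂ) (x : X) :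
    decayCalc T (fun s => a * k s) x = a • decayCalc T k x := by
  rw [hT.decayCalc_apply (hk.const_mul a), hT.decayCalc_apply hk, ← integral_smul]
  simp only [kernel_const_mul, mul_smul]

theorem norm_fourier_expCut_le (hT : IsStableSemigroup T M ω) (hc : -ω < c) (x : X) (ξ : ℝ) :
    ‖𝓕 (expCut c (T · x)) ξ‖ ≤ M * (ω + c)⁻¹ * ‖x‖ := by
  rw [hT.fourier_expCut hc]
  simpa using hT.norm_laplaceResolvent_apply_le (a := vertLine c ξ) (by simpa using hc) x

theorem norm_lineSymbol_le_of_isDecaying (hT : IsStableSemigroup T M ω) (hk : IsDecaying k C)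
    (hc : c ∈ Ico (-(ω / 2)) 0) (x : X) (ξ : ℝ) :
    ‖lineSymbol T k c x ξ‖ ≤ C * (1 + (2 * π * ξ) ^ 2)⁻¹ * (M * (ω / 2)⁻¹ * ‖x‖) := by
  have hω := hT.pos
  have hM := hT.nonneg
  have hfourier : ‖𝓕 (expCut c (T · x)) ξ‖ ≤ M * (ω / 2)⁻¹ * ‖x‖ := by
    refine (hT.norm_fourier_expCut_le (by linarith [hc.1]) x ξ).trans ?_
    gcongr
    linarith [hc.1]
  rw [lineSymbol, norm_smul]
  exact mul_le_mul (hk.norm_vertLine_le hc.2 ξ) hfourier (norm_nonneg _)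
    (mul_nonneg hk.nonneg (by positivity))

theorem integrable_lineSymbol (hT : IsStableSemigroup T M ω) (hk : IsDecaying k C)
    (hc : c ∈ Ioo (-ω) 0) (x : X) : Integrable (lineSymbol T k c x) :=
  (hk.integrable_vertLine hc.2).smul_bdd (M * (ω + c)⁻¹ * ‖x‖)
    (continuous_fourier_of_integrable (hT.integrable_expCut hc.1 x)).aestronglyMeasurable
    (Eventually.of_forall (hT.norm_fourier_expCut_le hc.1 x))

theorem neg_half_mem_Ioo (hT : IsStableSemigroup T M ω) : -(ω / 2) ∈ Ioo (-ω) 0 :=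
  ⟨neg_lt_neg (half_lt_self hT.pos), neg_lt_zero.2 (half_pos hT.pos)⟩

variable [CompleteSpace X]

theorem decayCalc_comm (hT : IsStableSemigroup T M ω) (hk : IsDecaying k C) {t : ℝ} (ht : 0 ≤ t)
    (x : X) : decayCalc T k (T t x) = T t (decayCalc T k x) :=
  hT.phillipsOp_comm (hk.integrable_expCut_kernel hT.pos) ht x

theorem decayCalc_apply_shift (hT : IsStableSemigroup T M ω) (hk : IsDecaying k C)
    (hc : c ∈ Ioo (-ω) 0) {t : ℝ} (ht : 0 ≤ t) (x : X) :
    decayCalc T k (T t x) = Real.exp (c * t) • 𝓕⁻ (lineSymbol T k c x) t := by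
  have hind : ∀ τ, Real.exp (c * t) • 𝓕 (fun ξ => k (vertLine c ξ)) (τ - t) • expCut c (T · x) τ =
      (Ioi t).indicator (fun τ => kernel k (τ - t) • T τ x) τ := fun τ => by
    rw [hk.fourier_vertLine hc.2]
    rcases le_or_gt τ t with hτ | hτ
    · rw [hk.kernel_of_nonpos (sub_nonpos.2 hτ), indicator_of_notMem (notMem_Ioi.2 hτ), smul_zero,
        zero_smul, smul_zero]
    · rw [expCut_of_pos (ht.trans_lt hτ), indicator_of_mem (mem_Ioi.2 hτ), smul_assoc,
        smul_comm (kernel k _), smul_smul, smul_smul, ← Real.exp_add, ← Real.exp_add]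
      ring_nf
      simp
  calc decayCalc T k (T t x) = ∫ τ in Ioi t, kernel k (τ - t) • T τ x :=
        hT.phillipsOp_apply_shift (hk.integrable_expCut_kernel hT.pos) ht x
    _ = ∫ τ, Real.exp (c * t) • 𝓕 (fun ξ => k (vertLine c ξ)) (τ - t) • expCut c (T · x) τ := by
        rw [← integral_indicator measurableSet_Ioi]
        simp only [hind]
    _ = Real.exp (c * t) • 𝓕⁻ (lineSymbol T k c x) t := by
        rw [integral_smul, ← fourierInv_smul_fourier (hk.integrable_vertLine hc.2)
          (hT.integrable_expCut hc.1 x)]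
        rfl

theorem decayCalc_eq_integral (hT : IsStableSemigroup T M ω) (hk : IsDecaying k C)
    (hc : c ∈ Ioo (-ω) 0) (x : X) : decayCalc T k x = ∫ ξ, lineSymbol T k c x ξ := by
  simpa [hT.map_zero, Real.fourierInv_eq'] using hT.decayCalc_apply_shift hk hc le_rfl x

theorem decayCalc_phillipsOp (hT : IsStableSemigroup T M ω) (hk : IsDecaying k C)
    (hc : c ∈ Ioo (-ω) 0) {φ : ℝ → ℂ} (hφ : Integrable (expCut (-c) φ)) {p : ℂ → ℂ} {D : ℝ}
    (hp : ∀ ξ : ℝ, laplaceTransform φ (-vertLine c ξ) = p (vertLine c ξ))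
    (hpk : IsDecaying (fun s => p s * k s) D) (x : X) :
    decayCalc T k (phillipsOp T φ x) = decayCalc T (fun s => p s * k s) x := by
  have hφω : Integrable (expCut ω φ) := integrable_expCut_mono (neg_le.1 hc.1.le) hφ
  calc decayCalc T k (phillipsOp T φ x) = ∫ t in Ioi (0 : ℝ), φ t • decayCalc T k (T t x) :=
        hT.map_phillipsOp hφω _ x
    _ = ∫ t, expCut (-c) φ t • 𝓕⁻ (lineSymbol T k c x) t := by
        rw [← integral_indicator measurableSet_Ioi]
        congr 1 with t
        rcases le_or_gt t 0 with ht | ht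
        · rw [expCut_of_nonpos ht, indicator_of_notMem (notMem_Ioi.2 ht), zero_smul]
        · rw [expCut_of_pos ht, indicator_of_mem (mem_Ioi.2 ht),
            hT.decayCalc_apply_shift hk hc ht.le, smul_comm, neg_neg, smul_assoc]
    _ = ∫ ξ, 𝓕⁻ (expCut (-c) φ) ξ • lineSymbol T k c x ξ :=
        (integral_fourierInv_smul_eq_integral_smul_fourierInv hφ
          (hT.integrable_lineSymbol hk hc x)).symm
    _ = ∫ ξ, lineSymbol T (fun s => p s * k s) c x ξ := by
        simp only [fourierInv_expCut, hp, lineSymbol, smul_smul]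
    _ = decayCalc T (fun s => p s * k s) x := (hT.decayCalc_eq_integral hpk hc x).symm

theorem decayCalc_mul (hT : IsStableSemigroup T M ω) (h₁ : IsDecaying k₁ C₁)
    (h₂ : IsDecaying k₂ C₂) (x : X) :
    decayCalc T k₁ (decayCalc T k₂ x) = decayCalc T (fun s => k₂ s * k₁ s) x := by
  have hc := hT.neg_half_mem_Ioo
  exact hT.decayCalc_phillipsOp h₁ hc (h₂.integrable_expCut_kernel (neg_pos.2 hc.2))
    (h₂.laplaceTransform_kernel hc.2) (h₂.mul h₁) x

theorem decayCalc_laplaceResolvent (hT : IsStableSemigroup T M ω) (hk : IsDecaying k C) {a : ℂ}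
    (ha : 0 < a.re) {D : ℝ} (hak : IsDecaying (fun s => (a - s)⁻¹ * k s) D) (x : X) :
    decayCalc T k (laplaceResolvent T a x) = decayCalc T (fun s => (a - s)⁻¹ * k s) x := by
  have hc := hT.neg_half_mem_Ioo
  refine hT.decayCalc_phillipsOp hk hc (integrable_expCut_cexp ?_) (fun ξ => ?_) hak x
  · linarith [hc.2]
  · rw [laplaceTransform_cexp, sub_eq_add_neg]
    rw [Complex.add_re, Complex.neg_re, vertLine_re]
    linarith [hc.2]

theorem tendsto_decayCalc (hT : IsStableSemigroup T M ω) {f : ℕ → ℂ → ℂ}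
    (hf : ∀ n, IsDecaying (f n) C) (hk : IsDecaying k C₁)
    (hlim : ∀ s : ℂ, s.re < 0 → Tendsto (fun n => f n s) atTop (𝓝 (k s))) (x : X) :
    Tendsto (fun n => decayCalc T (f n) x) atTop (𝓝 (decayCalc T k x)) := by
  have hc := hT.neg_half_mem_Ioo
  simp only [hT.decayCalc_eq_integral hk hc, fun n => hT.decayCalc_eq_integral (hf n) hc]
  exact tendsto_integral_of_dominated_convergence
    (fun ξ => C * (1 + (2 * π * ξ) ^ 2)⁻¹ * (M * (ω / 2)⁻¹ * ‖x‖))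
    (fun n => (hT.integrable_lineSymbol (hf n) hc x).1)
    ((integrable_inv_one_add_two_pi_mul_sq.const_mul C).mul_const _)
    (fun n => Eventually.of_forall
      (hT.norm_lineSymbol_le_of_isDecaying (hf n) (left_mem_Ico.2 hc.2) x))
    (Eventually.of_forall fun ξ => (hlim _ (by simpa using hT.pos)).smul_const _)

end IsStableSemigroup

end Calculus

section Bounds

/-- The constant `B` bounds the `L²` norm of the orbit map of every operator `k(A)` with a
quadratically decaying symbol `k`, relative to the supremum of `|k|` on the left half-plane. -/
structure IsOrbitBound {X : Type*} [NormedAddCommGroup X] [NormedSpace ℂ X]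
    (T : ℝ → X →L[ℂ] X) (B : ℝ) : Prop where
  nonneg : 0 ≤ B
  eLpNorm_le : ∀ {k : ℂ → ℂ} {C m : ℝ}, IsDecaying k C → (∀ s : ℂ, s.re < 0 → ‖k s‖ ≤ m) →
    ∀ x : X, eLpNorm (fun t => decayCalc T k (T t x)) 2 (volume.restrict (Ioi 0)) ≤
      ENNReal.ofReal (B * m * ‖x‖)

namespace IsStableSemigroup

section LTwo

variable {X : Type*} [NormedAddCommGroup X] [InnerProductSpace ℂ X] [CompleteSpace X]
  {T : ℝ → X →L[ℂ] X} {M ω c : ℝ} {k : ℂ → ℂ} {C m : ℝ}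

theorem memLp_two_lineSymbol (hT : IsStableSemigroup T M ω) (hk : IsDecaying k C)
    (hm : ∀ s : ℂ, s.re < 0 → ‖k s‖ ≤ m) (hc : c ∈ Ioo (-ω) 0) (x : X) :
    MemLp (lineSymbol T k c x) 2 :=
  (memLp_two_fourier (hT.integrable_expCut hc.1 x) (hT.memLp_two_expCut hc.1 x)).of_le_mul
    (hT.integrable_lineSymbol hk hc x).1 (Eventually.of_forall (norm_lineSymbol_le hm hc.2 x))

theorem eLpNorm_two_decayCalc_le (hT : IsStableSemigroup T M ω) (hk : IsDecaying k C)
    (hm : ∀ s : ℂ, s.re < 0 → ‖k s‖ ≤ m) (hc : c ∈ Ioo (-ω) 0) (x : X) :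
    eLpNorm (fun t => decayCalc T k (T t x)) 2 (volume.restrict (Ioi 0)) ≤
      ENNReal.ofReal m * eLpNorm (expCut c (T · x)) 2 volume := by
  calc eLpNorm (fun t => decayCalc T k (T t x)) 2 (volume.restrict (Ioi 0))
      ≤ eLpNorm (𝓕⁻ (lineSymbol T k c x)) 2 (volume.restrict (Ioi 0)) := by
        refine eLpNorm_mono_ae ?_
        filter_upwards [ae_restrict_mem measurableSet_Ioi] with t ht
        rw [hT.decayCalc_apply_shift hk hc (le_of_lt ht), norm_smul, Real.norm_eq_abs,
          Real.abs_exp]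
        exact mul_le_of_le_one_left (norm_nonneg _)
          (Real.exp_le_one_iff.2 (mul_nonpos_of_nonpos_of_nonneg hc.2.le (le_of_lt ht)))
    _ ≤ eLpNorm (𝓕⁻ (lineSymbol T k c x)) 2 volume :=
        eLpNorm_mono_measure _ Measure.restrict_le_self
    _ = eLpNorm (lineSymbol T k c x) 2 volume :=
        eLpNorm_two_fourierInv (hT.integrable_lineSymbol hk hc x)
          (hT.memLp_two_lineSymbol hk hm hc x)
    _ ≤ ENNReal.ofReal m * eLpNorm (𝓕 (expCut c (T · x))) 2 volume :=
        eLpNorm_le_mul_eLpNorm_of_ae_le_mul (Eventually.of_forall (norm_lineSymbol_le hm hc.2 x)) 2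
    _ = ENNReal.ofReal m * eLpNorm (expCut c (T · x)) 2 volume := by
        rw [eLpNorm_two_fourier (hT.integrable_expCut hc.1 x) (hT.memLp_two_expCut hc.1 x)]

theorem exists_isOrbitBound (hT : IsStableSemigroup T M ω) : ∃ B, IsOrbitBound T B := by
  have hc := hT.neg_half_mem_Ioo
  obtain ⟨B, hB, horbit⟩ := hT.exists_eLpNorm_two_expCut_le hc.1
  refine ⟨B, hB, fun {k C m} hk hm x => ?_⟩
  have hm0 : 0 ≤ m := (norm_nonneg _).trans (hm (-1) (by simp))
  calc eLpNorm (fun t => decayCalc T k (T t x)) 2 (volume.restrict (Ioi 0))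
      ≤ ENNReal.ofReal m * ENNReal.ofReal (B * ‖x‖) :=
        (hT.eLpNorm_two_decayCalc_le hk hm hc x).trans (mul_le_mul_right (horbit x) _)
    _ = ENNReal.ofReal (B * m * ‖x‖) := by
        rw [← ENNReal.ofReal_mul hm0, mul_left_comm, ← mul_assoc]

end LTwo

section Pointwise

variable {X : Type*} [NormedAddCommGroup X] [NormedSpace ℂ X]
  {T : ℝ → X →L[ℂ] X} {M ω : ℝ} {K : X →L[ℂ] X} {x : X} {b : ℝ}

-- `‖K T(t) x‖ ≤ M ‖K T(s) x‖` for `s ≤ t`, so the square integral over `(0, t)` controls the norm.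
theorem norm_map_apply_le_of_eLpNorm_le (hT : IsStableSemigroup T M ω)
    (hcomm : ∀ s : ℝ, 0 ≤ s → ∀ x, K (T s x) = T s (K x)) (hb : 0 ≤ b)
    (hK : eLpNorm (fun t => K (T t x)) 2 (volume.restrict (Ioi 0)) ≤ ENNReal.ofReal b)
    {t : ℝ} (ht : 0 < t) : ‖K (T t x)‖ ≤ M * b / √t := by
  have hdom : ∀ s ∈ Ioc 0 t, ‖K (T t x)‖ ≤ M * ‖K (T s x)‖ := fun s hs => by
    have hts : 0 ≤ t - s := sub_nonneg.2 hs.2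
    rw [← sub_add_cancel t s, hT.apply_add hts hs.1.le, hcomm _ hts]
    exact (T (t - s)).le_of_opNorm_le (hT.norm_le_const hts) _
  have hnorm : eLpNorm (fun _ : ℝ => K (T t x)) 2 (volume.restrict (Ioc 0 t)) ≤
      ENNReal.ofReal (M * b) := by
    calc eLpNorm (fun _ : ℝ => K (T t x)) 2 (volume.restrict (Ioc 0 t))
        ≤ ENNReal.ofReal M * eLpNorm (fun s => K (T s x)) 2 (volume.restrict (Ioc 0 t)) :=
          eLpNorm_le_mul_eLpNorm_of_ae_le_mul
            ((ae_restrict_mem measurableSet_Ioc).mono hdom) 2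
      _ ≤ ENNReal.ofReal M * ENNReal.ofReal b :=
          mul_le_mul_right ((eLpNorm_mono_measure _
            (Measure.restrict_mono Ioc_subset_Ioi_self le_rfl)).trans hK) _
      _ = ENNReal.ofReal (M * b) := (ENNReal.ofReal_mul hT.nonneg).symm
  have hμ : volume.restrict (Ioc 0 t) ≠ 0 := by
    simpa only [ne_eq, Measure.restrict_eq_zero, Real.volume_Ioc, sub_zero,
      ENNReal.ofReal_eq_zero, not_le] using ht
  rw [eLpNorm_const _ two_ne_zero hμ, Measure.restrict_apply_univ, Real.volume_Ioc, sub_zero,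
    ← ofReal_norm, ENNReal.ofReal_rpow_of_pos ht, ← ENNReal.ofReal_mul (norm_nonneg _),
    ENNReal.ofReal_le_ofReal_iff (mul_nonneg hT.nonneg hb)] at hnorm
  rw [le_div_iff₀ (Real.sqrt_pos.2 ht), Real.sqrt_eq_rpow]
  simpa using hnorm

theorem norm_map_laplaceResolvent_le [CompleteSpace X] (hT : IsStableSemigroup T M ω)
    (hK : ∀ t : ℝ, 0 < t → ‖K (T t x)‖ ≤ b / √t) :
    ‖K (laplaceResolvent T 1 x)‖ ≤ b * Real.Gamma (1 / 2) := by
  have hexp : Integrable (expCut ω fun t => Complex.exp (-(1 : ℂ) * t)) :=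
    integrable_expCut_cexp (by linarith [hT.pos, Complex.one_re])
  rw [laplaceResolvent, hT.map_phillipsOp hexp, Real.Gamma_eq_integral (by norm_num),
    ← integral_const_mul]
  refine norm_integral_le_of_norm_le
    ((Real.GammaIntegral_convergent (by norm_num : (0 : ℝ) < 1 / 2)).const_mul b) ?_
  filter_upwards [ae_restrict_mem measurableSet_Ioi] with t ht
  have hpow : t ^ ((1 : ℝ) / 2 - 1) = (√t)⁻¹ := by
    rw [Real.sqrt_eq_rpow, ← Real.rpow_neg (le_of_lt ht)]
    norm_num
  calc ‖Complex.exp (-1 * t) • K (T t x)‖ = Real.exp (-t) * ‖K (T t x)‖ := by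
        simp [norm_smul, Complex.norm_exp]
    _ ≤ Real.exp (-t) * (b / √t) := mul_le_mul_of_nonneg_left (hK t ht) (Real.exp_nonneg _)
    _ = b * (Real.exp (-t) * t ^ ((1 : ℝ) / 2 - 1)) := by rw [hpow]; ring

end Pointwise

end IsStableSemigroup

end Bounds

section Approximation

theorem differentiableOn_inv_sub {a : ℂ} (ha : 0 < a.re) :
    DifferentiableOn ℂ (fun s => (a - s)⁻¹) leftHalfPlane := by
  refine DifferentiableOn.inv (by fun_prop) fun s (hs : s.re < 0) h => ?_
  rw [sub_eq_zero.1 h] at ha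
  exact lt_asymm ha hs

theorem norm_inv_sub_le {a s : ℂ} (ha : 0 < a.re) (hs : s.re ≤ 0) : ‖(a - s)⁻¹‖ ≤ a.re⁻¹ := by
  rw [norm_inv]
  refine inv_anti₀ ha ((Complex.re_le_norm _).trans' ?_)
  simpa using hs

theorem isBoundedHolo_inv_sub {a : ℂ} (ha : 0 < a.re) :
    IsBoundedHolo (fun s => (a - s)⁻¹) a.re⁻¹ :=
  ⟨differentiableOn_inv_sub ha, fun _ hs => norm_inv_sub_le ha hs.le⟩

theorem norm_inv_sub_sq_le {r : ℝ} (hr : 1 ≤ r) {s : ℂ} (hs : s.re ≤ 0) :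
    ‖((r : ℂ) - s)⁻¹‖ * ‖((r : ℂ) - s)⁻¹‖ ≤ (1 + s.im ^ 2)⁻¹ := by
  rw [norm_inv, ← mul_inv, Complex.norm_mul_self_eq_normSq, Complex.normSq_apply]
  refine inv_anti₀ (by positivity) ?_
  simp only [Complex.sub_re, Complex.ofReal_re, Complex.sub_im, Complex.ofReal_im, zero_sub]
  nlinarith

theorem IsBoundedHolo.isDecaying_inv_sub_sq_mul {g : ℂ → ℂ} {m r : ℝ} (hg : IsBoundedHolo g m)
    (hr : 1 ≤ r) : IsDecaying (fun s => ((r : ℂ) - s)⁻¹ * (((r : ℂ) - s)⁻¹ * g s)) m where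
  differentiableOn := by
    have hinv := differentiableOn_inv_sub (a := r) (by simpa using zero_lt_one.trans_le hr)
    exact hinv.mul (hinv.mul hg.differentiableOn)
  norm_le s hs := by
    rw [norm_mul, norm_mul, ← mul_assoc, mul_comm m]
    exact mul_le_mul (norm_inv_sub_sq_le hr hs.le) (hg.norm_le s hs) (norm_nonneg _) (by positivity)

/-- The function `(1-s)⁻² g(s)`, by which a bounded function `g` is made quadratically decaying. -/
noncomputable def regularize (g : ℂ → ℂ) (s : ℂ) : ℂ := (1 - s)⁻¹ * ((1 - s)⁻¹ * g s)

/-- The function `s ↦ (n+1)/(n+1-s)`; it corresponds to the Yosida regularization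
`(n+1)(n+1-A)⁻¹` of the identity. -/
noncomputable def yosidaFactor (n : ℕ) (s : ℂ) : ℂ := ((n : ℂ) + 1) * ((n : ℂ) + 1 - s)⁻¹

/-- Quadratically decaying approximants of a bounded function `g`, with the same bound. -/
noncomputable def yosidaApprox (g : ℂ → ℂ) (n : ℕ) (s : ℂ) : ℂ :=
  yosidaFactor n s * (yosidaFactor n s * g s)

theorem natCast_add_one_re_pos (n : ℕ) : 0 < ((n : ℂ) + 1).re := by
  simpa using n.cast_add_one_pos

theorem norm_yosidaFactor_le (n : ℕ) {s : ℂ} (hs : s.re ≤ 0) : ‖yosidaFactor n s‖ ≤ 1 := by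
  have hnorm : ‖(n : ℂ) + 1‖ = ((n : ℂ) + 1).re := by
    simpa using RCLike.norm_natCast (K := ℂ) (n + 1)
  rw [yosidaFactor, norm_mul, hnorm]
  exact (mul_le_mul_of_nonneg_left (norm_inv_sub_le (natCast_add_one_re_pos n) hs)
    (natCast_add_one_re_pos n).le).trans_eq (mul_inv_cancel₀ (natCast_add_one_re_pos n).ne')

theorem tendsto_yosidaFactor (s : ℂ) : Tendsto (fun n => yosidaFactor n s) atTop (𝓝 1) := by
  have hinv : Tendsto (fun n : ℕ => ((n : ℂ) + 1)⁻¹) atTop (𝓝 0) := by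
    simpa using tendsto_one_div_add_atTop_nhds_zero_nat (𝕜 := ℂ)
  have hlim : Tendsto (fun n : ℕ => (1 - s * ((n : ℂ) + 1)⁻¹)⁻¹) atTop (𝓝 1) := by
    simpa using ((hinv.const_mul s).const_sub 1).inv₀ (by simp)
  refine hlim.congr fun n => ?_
  have hn : (n : ℂ) + 1 ≠ 0 := n.cast_add_one_ne_zero
  have hfactor : 1 - s * ((n : ℂ) + 1)⁻¹ = ((n : ℂ) + 1)⁻¹ * ((n : ℂ) + 1 - s) := by field_simp
  rw [yosidaFactor, hfactor, mul_inv, inv_inv]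

theorem isBoundedHolo_yosidaFactor (n : ℕ) : IsBoundedHolo (yosidaFactor n) 1 :=
  ⟨(differentiableOn_inv_sub (natCast_add_one_re_pos n)).const_mul _,
    fun _ hs => norm_yosidaFactor_le n hs.le⟩

theorem tendsto_yosidaApprox (g : ℂ → ℂ) (s : ℂ) :
    Tendsto (fun n => yosidaApprox g n s) atTop (𝓝 (g s)) := by
  simpa [yosidaApprox] using (tendsto_yosidaFactor s).mul ((tendsto_yosidaFactor s).mul_const (g s))

namespace IsBoundedHolo

variable {g : ℂ → ℂ} {m : ℝ}

theorem isDecaying_regularize (hg : IsBoundedHolo g m) : IsDecaying (regularize g) m := by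
  have hdecay := hg.isDecaying_inv_sub_sq_mul le_rfl
  rw [Complex.ofReal_one] at hdecay
  exact hdecay

theorem isBoundedHolo_yosidaApprox (hg : IsBoundedHolo g m) (n : ℕ) :
    IsBoundedHolo (yosidaApprox g n) m := by
  have hbound := (isBoundedHolo_yosidaFactor n).mul ((isBoundedHolo_yosidaFactor n).mul hg)
  rw [one_mul, one_mul] at hbound
  exact hbound

theorem isDecaying_yosidaApprox (hg : IsBoundedHolo g m) (n : ℕ) :
    IsDecaying (yosidaApprox g n) (‖((n : ℂ) + 1) ^ 2‖ * m) := by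
  have hdecay := (hg.isDecaying_inv_sub_sq_mul (r := n + 1) (by simp)).const_mul (((n : ℂ) + 1) ^ 2)
  convert hdecay using 2 with s
  push_cast [yosidaApprox, yosidaFactor]
  ring

end IsBoundedHolo

theorem IsDecaying.isDecaying_yosidaApprox {k : ℂ → ℂ} {C : ℝ} (hk : IsDecaying k C) (n : ℕ) :
    IsDecaying (yosidaApprox k n) C := by
  have hdecay := (hk.bounded_mul (isBoundedHolo_yosidaFactor n)).bounded_mul
    (isBoundedHolo_yosidaFactor n)
  rw [one_mul, one_mul] at hdecay
  exact hdecay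

end Approximation

section Toeplitz

theorem tendsto_eLpNorm_of_dominated {α E : Type*} [MeasurableSpace α] {μ : Measure α}
    [NormedAddCommGroup E] {p : ENNReal} (hp : p ≠ ⊤) {f : ℕ → α → E} {f₀ : α → E} {b : α → ℝ}
    (hb : MemLp b p μ) (hf : ∀ n, AEStronglyMeasurable (f n) μ)
    (hle : ∀ n, ∀ᵐ a ∂μ, ‖f n a‖ ≤ b a)
    (hlim : ∀ᵐ a ∂μ, Tendsto (fun n => f n a) atTop (𝓝 (f₀ a))) :
    Tendsto (fun n => eLpNorm (f n - f₀) p μ) atTop (𝓝 0) := by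
  rcases eq_or_ne p 0 with rfl | hp0
  · simp
  have hp_pos := ENNReal.toReal_pos hp0 hp
  have hf₀ : AEStronglyMeasurable f₀ μ := aestronglyMeasurable_of_tendsto_ae atTop hf hlim
  have hsub_le : ∀ n, ∀ᵐ a ∂μ, ‖f n a - f₀ a‖ₑ ≤ ‖2 * b a‖ₑ := fun n => by
    filter_upwards [hlim, ae_all_iff.2 hle] with a ha hab
    refine enorm_le_iff_norm_le.2 (((norm_sub_le _ _).trans (add_le_add (hab n)
      (le_of_tendsto ha.norm (Eventually.of_forall hab)))).trans ?_)
    rw [← two_mul]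
    exact le_abs_self _
  have hlintegral : Tendsto (fun n => ∫⁻ a, ‖f n a - f₀ a‖ₑ ^ p.toReal ∂μ) atTop
      (𝓝 (∫⁻ _, 0 ∂μ)) := by
    refine tendsto_lintegral_of_dominated_convergence' (fun a => ‖2 * b a‖ₑ ^ p.toReal)
      (fun n => ((hf n).sub hf₀).enorm.pow_const _)
      (fun n => (hsub_le n).mono fun a ha => ENNReal.rpow_le_rpow ha hp_pos.le)
      (lintegral_rpow_enorm_lt_top_of_eLpNorm_lt_top hp0 hp (hb.const_mul 2).2).ne ?_
    filter_upwards [hlim] with a ha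
    simpa [hp_pos] using (ha.sub_const (f₀ a)).enorm.ennrpow_const p.toReal
  simpa [eLpNorm_eq_lintegral_rpow_enorm_toReal hp0 hp, hp_pos]
    using hlintegral.ennrpow_const (1 / p.toReal)

/-- `β ξ` is the boundary value of `k` at the point `2πiξ` of the imaginary axis, for almost every
frequency `ξ`. -/
def HasBoundarySymbol (k : ℂ → ℂ) (β : ℝ → ℂ) : Prop :=
  ∀ᵐ ξ : ℝ, Tendsto (fun c => k (vertLine c ξ)) (𝓝[<] 0) (𝓝 (β ξ))

theorem continuousAt_yosidaFactor (n : ℕ) {s : ℂ} (hs : s.re ≤ 0) :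
    ContinuousAt (yosidaFactor n) s := by
  refine continuousAt_const.mul (ContinuousAt.inv₀ (by fun_prop) fun h => ?_)
  have hpos := natCast_add_one_re_pos n
  rw [sub_eq_zero.1 h] at hpos
  exact hs.not_gt hpos

namespace HasBoundarySymbol

variable {k : ℂ → ℂ} {β : ℝ → ℂ} {C m : ℝ}

theorem norm_le (hβ : HasBoundarySymbol k β) (hk : IsBoundedHolo k m) : ∀ᵐ ξ, ‖β ξ‖ ≤ m := by
  filter_upwards [hβ] with ξ hξ
  refine le_of_tendsto hξ.norm ?_
  filter_upwards [self_mem_nhdsWithin] with c hc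
  exact hk.norm_le _ (by simpa using hc)

theorem integrable (hβ : HasBoundarySymbol k β) (hk : IsDecaying k C) : Integrable β := by
  have hmeas : AEStronglyMeasurable β := by
    obtain ⟨c, -, hc_neg, hc⟩ := exists_seq_strictMono_tendsto (0 : ℝ)
    have hc' : Tendsto c atTop (𝓝[<] 0) :=
      tendsto_nhdsWithin_iff.2 ⟨hc, Eventually.of_forall hc_neg⟩
    exact aestronglyMeasurable_of_tendsto_ae atTop
      (fun n => (hk.continuous_vertLine (hc_neg n)).aestronglyMeasurable)
      (hβ.mono fun ξ hξ => hξ.comp hc')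
  refine (integrable_inv_one_add_two_pi_mul_sq.const_mul C).mono' hmeas ?_
  filter_upwards [hβ] with ξ hξ
  refine le_of_tendsto hξ.norm ?_
  filter_upwards [self_mem_nhdsWithin] with c hc
  exact hk.norm_vertLine_le hc ξ

theorem yosidaApprox (hβ : HasBoundarySymbol k β) (n : ℕ) :
    HasBoundarySymbol (yosidaApprox k n) fun ξ =>
      yosidaFactor n (vertLine 0 ξ) * (yosidaFactor n (vertLine 0 ξ) * β ξ) := by
  filter_upwards [hβ] with ξ hξ
  have hline : ContinuousAt (fun c => vertLine c ξ) 0 := by unfold vertLine; fun_prop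
  have hfactor : Tendsto (fun c => yosidaFactor n (vertLine c ξ)) (𝓝[<] 0)
      (𝓝 (yosidaFactor n (vertLine 0 ξ))) :=
    (ContinuousAt.comp (g := yosidaFactor n) (continuousAt_yosidaFactor n (by simp))
      hline).mono_left nhdsWithin_le_nhds
  exact hfactor.mul (hfactor.mul hξ)

end HasBoundarySymbol

theorem IsStableSemigroup.decayCalc_apply_shift_boundary {X : Type*} [NormedAddCommGroup X]
    [NormedSpace ℂ X] [CompleteSpace X] {T : ℝ → X →L[ℂ] X} {M ω : ℝ}
    (hT : IsStableSemigroup T M ω) {k : ℂ → ℂ} {C : ℝ} (hk : IsDecaying k C) {β : ℝ → ℂ}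
    (hβ : HasBoundarySymbol k β) {t : ℝ} (ht : 0 ≤ t) (x : X) :
    decayCalc T k (T t x) = 𝓕⁻ (fun ξ => β ξ • 𝓕 (expCut 0 (T · x)) ξ) t := by
  have hstrip : ∀ᶠ c in 𝓝[<] (0 : ℝ), c ∈ Ico (-(ω / 2)) 0 :=
    Ico_mem_nhdsLT hT.neg_half_mem_Ioo.2
  have hIoo : ∀ {c}, c ∈ Ico (-(ω / 2)) 0 → c ∈ Ioo (-ω) 0 := fun hc =>
    ⟨hT.neg_half_mem_Ioo.1.trans_le hc.1, hc.2⟩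
  have hsymbol : Tendsto (fun c => 𝓕⁻ (lineSymbol T k c x) t) (𝓝[<] 0)
      (𝓝 (𝓕⁻ (fun ξ => β ξ • 𝓕 (expCut 0 (T · x)) ξ) t)) := by
    simp only [Real.fourierInv_eq]
    refine tendsto_integral_filter_of_dominated_convergence
      (fun ξ => C * (1 + (2 * π * ξ) ^ 2)⁻¹ * (M * (ω / 2)⁻¹ * ‖x‖))
      (hstrip.mono fun c hc => ?_) (hstrip.mono fun c hc => Eventually.of_forall fun ξ => ?_)
      ((integrable_inv_one_add_two_pi_mul_sq.const_mul C).mul_const _) ?_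
    · exact Continuous.aestronglyMeasurable (by fun_prop) |>.smul
        (hT.integrable_lineSymbol hk (hIoo hc) x).1
    · rw [Circle.norm_smul]
      exact hT.norm_lineSymbol_le_of_isDecaying hk hc x ξ
    · filter_upwards [hβ] with ξ hξ
      have horbit := continuousAt_fourier_expCut hT.neg_half_mem_Ioo.2
        (hT.integrable_expCut hT.neg_half_mem_Ioo.1 x) ξ
      exact (hξ.smul (horbit.mono_left nhdsWithin_le_nhds)).const_smul _
  have hexp : Tendsto (fun c : ℝ => Real.exp (c * t)) (𝓝[<] 0) (𝓝 1) := by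
    have hcont : Continuous fun c : ℝ => Real.exp (c * t) := by fun_prop
    simpa using (hcont.tendsto 0).mono_left (nhdsWithin_le_nhds (s := Iio 0))
  refine tendsto_nhds_unique (tendsto_const_nhds.congr' ?_)
    (by simpa only [one_smul] using hexp.smul hsymbol)
  filter_upwards [hstrip] with c hc
  exact hT.decayCalc_apply_shift hk (hIoo hc) ht x

variable {X : Type*} [NormedAddCommGroup X] [InnerProductSpace ℂ X] [CompleteSpace X]

theorem isToeplitzImage_of_tendsto {f u : ℝ → X} {b : ℝ → ℂ} {q : ℕ → ℝ → ℂ} {m : ℝ}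
    (hf : Integrable ((Ioi 0).indicator f)) (hf₂ : MemLp ((Ioi 0).indicator f) 2)
    (hq : ∀ n, Integrable (q n)) (hqm : ∀ n, ∀ᵐ ξ, ‖q n ξ‖ ≤ m)
    (hlim : ∀ᵐ ξ : ℝ, Tendsto (fun n => q n ξ) atTop (𝓝 (b (2 * π * ξ))))
    (hu : ∀ t : ℝ, 0 < t →
      Tendsto (fun n => 𝓕⁻ (fun ξ => q n ξ • 𝓕 ((Ioi 0).indicator f) ξ) t) atTop (𝓝 (u t))) :
    IsToeplitzImage b f u := by
  set F : ℝ → X := 𝓕 ((Ioi 0).indicator f)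
  have hF₂ : MemLp F 2 := memLp_two_fourier hf hf₂
  have hint : ∀ n, Integrable fun ξ => q n ξ • F ξ := fun n =>
    (hq n).smul_bdd (∫ t, ‖(Ioi 0).indicator f t‖) hF₂.1 (Eventually.of_forall fun ξ =>
      VectorFourier.norm_fourierIntegral_le_integral_norm _ _ _ _ _)
  have hle : ∀ n, ∀ᵐ ξ, ‖q n ξ • F ξ‖ ≤ m * ‖F ξ‖ := fun n => (hqm n).mono fun ξ hξ => by
    rw [norm_smul]
    gcongr
  have hlim' : ∀ᵐ ξ : ℝ, Tendsto (fun n => q n ξ • F ξ) atTop (𝓝 (b (2 * π * ξ) • F ξ)) :=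
    hlim.mono fun ξ hξ => hξ.smul_const _
  have hmem : ∀ n, MemLp (fun ξ => q n ξ • F ξ) 2 := fun n =>
    hF₂.of_le_mul (hint n).1 (hle n)
  have hmem₀ : MemLp (fun ξ : ℝ => b (2 * π * ξ) • F ξ) 2 :=
    hF₂.of_le_mul (aestronglyMeasurable_of_tendsto_ae atTop (fun n => (hint n).1) hlim') <| by
      filter_upwards [hlim', ae_all_iff.2 hle] with ξ hξ hξm
      exact le_of_tendsto hξ.norm (Eventually.of_forall hξm)
  have hconv : Tendsto (fun n => 𝓕⁻ ((hmem n).toLp _)) atTop (𝓝 (𝓕⁻ (hmem₀.toLp _))) :=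
    ((Lp.fourierTransformₗᵢ ℝ X).symm.continuous.tendsto _).comp
      ((Lp.tendsto_Lp_iff_tendsto_eLpNorm'' _ hmem _ hmem₀).2
        (tendsto_eLpNorm_of_dominated (by simp) (hF₂.norm.const_mul m) (fun n => (hint n).1)
          hle hlim'))
  obtain ⟨ns, hns, hae⟩ := (tendstoInMeasure_of_tendsto_Lp hconv).exists_seq_tendsto_ae
  refine ⟨hf₂.toLp _, 𝓕⁻ (hmem₀.toLp _), hf₂.coeFn_toLp, ?_, ?_⟩
  · rw [FourierTransform.fourier_fourierInv_eq]
    filter_upwards [hmem₀.coeFn_toLp, fourier_toLp_ae_eq hf hf₂] with ξ h₀ h₁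
    rw [h₀, h₁]
  · have hinv := ae_all_iff.2 fun n => fourierInv_toLp_ae_eq (hint n) (hmem n)
    refine (ae_restrict_iff' measurableSet_Ioi).2 ?_
    filter_upwards [hae, hinv] with t htendsto hinv_t ht
    refine tendsto_nhds_unique htendsto (((hu t ht).comp hns.tendsto_atTop).congr fun i => ?_)
    exact (hinv_t (ns i)).symm

theorem IsToeplitzImage.ae_eq_of_one {f u : ℝ → X} (h : IsToeplitzImage (fun _ => 1) f u) :
    u =ᵐ[volume.restrict (Ioi 0)] f := by
  obtain ⟨F, G, hF, hG, hu⟩ := h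
  have hGF : G = F := by
    refine (Lp.fourierTransformₗᵢ ℝ X).injective
      (Lp.ext (hG.trans (Eventually.of_forall fun ξ => ?_)))
    exact one_smul ℂ _
  filter_upwards [hu, ae_restrict_of_ae hF, ae_restrict_mem measurableSet_Ioi] with t hut hFt ht
  rw [← hut, hGF, hFt, indicator_of_mem ht]

theorem IsStableSemigroup.isToeplitzImage {T : ℝ → X →L[ℂ] X} {M ω : ℝ}
    (hT : IsStableSemigroup T M ω) {g : ℂ → ℂ} {m : ℝ} (hg : IsBoundedHolo g m) {b : ℝ → ℂ}
    (hb : HasBoundarySymbol g fun ξ => b (2 * π * ξ)) {x : X} {u : ℝ → X}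
    (hu : ∀ t : ℝ, 0 < t →
      Tendsto (fun n => decayCalc T (yosidaApprox g n) (T t x)) atTop (𝓝 (u t))) :
    IsToeplitzImage b (T · x) u := by
  have hcut : expCut 0 (T · x) = (Ioi 0).indicator (T · x) := by simp [expCut]
  have hω : -ω < 0 := neg_lt_zero.2 hT.pos
  refine isToeplitzImage_of_tendsto (hcut ▸ hT.integrable_expCut hω x)
    (hcut ▸ hT.memLp_two_expCut hω x)
    (fun n => (hb.yosidaApprox n).integrable (hg.isDecaying_yosidaApprox n))
    (fun n => (hb.yosidaApprox n).norm_le (hg.isBoundedHolo_yosidaApprox n))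
    (Eventually.of_forall fun ξ => ?_) fun t ht => (hu t ht).congr fun n => ?_
  · simpa using (tendsto_yosidaFactor _).mul ((tendsto_yosidaFactor (vertLine 0 ξ)).mul_const _)
  · rw [← hcut]
    exact hT.decayCalc_apply_shift_boundary (hg.isDecaying_yosidaApprox n) (hb.yosidaApprox n)
      ht.le x

end Toeplitz

section StrongLimits

section NontriviallyNormed

variable {𝕜 X Y ι : Type*} [NontriviallyNormedField 𝕜] [NormedAddCommGroup X] [NormedSpace 𝕜 X]
  [NormedAddCommGroup Y] [NormedSpace 𝕜 Y] {L : ℕ → X →L[𝕜] Y} {C : ℝ} {P : ι → X}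

theorem cauchySeq_apply_of_denseRange (hL : ∀ n, ‖L n‖ ≤ C) (hP : DenseRange P)
    (hlim : ∀ i, CauchySeq fun n => L n (P i)) (x : X) : CauchySeq fun n => L n x := by
  have hC : 0 ≤ C := (norm_nonneg _).trans (hL 0)
  refine Metric.cauchySeq_iff.2 fun ε hε => ?_
  have hδ : 0 < ε / (3 * (C + 1)) := by positivity
  obtain ⟨i, hi⟩ := hP.exists_dist_lt x hδ
  obtain ⟨N, hN⟩ := Metric.cauchySeq_iff.1 (hlim i) (ε / 3) (by positivity)
  have hdist : ∀ n, dist (L n x) (L n (P i)) < ε / 3 := fun n => by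
    calc dist (L n x) (L n (P i)) ≤ C * dist x (P i) := by
          simpa only [dist_eq_norm, map_sub] using (L n).le_of_opNorm_le (hL n) (x - P i)
      _ ≤ (C + 1) * dist x (P i) := by gcongr; linarith
      _ < (C + 1) * (ε / (3 * (C + 1))) := by gcongr
      _ = ε / 3 := by field_simp
  refine ⟨N, fun a ha b hb => ?_⟩
  have htriangle := dist_triangle4 (L a x) (L a (P i)) (L b (P i)) (L b x)
  linarith [hdist a, hN a ha b hb, hdist b, dist_comm (L b x) (L b (P i))]

theorem exists_tendsto_apply_of_denseRange [CompleteSpace Y] (hL : ∀ n, ‖L n‖ ≤ C)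
    (hP : DenseRange P) (hlim : ∀ i, CauchySeq fun n => L n (P i)) :
    ∃ L₀ : X →L[𝕜] Y, ‖L₀‖ ≤ C ∧ ∀ x, Tendsto (fun n => L n x) atTop (𝓝 (L₀ x)) := by
  choose f hf using fun x =>
    cauchySeq_tendsto_of_complete (cauchySeq_apply_of_denseRange hL hP hlim x)
  refine ⟨.ofTendstoOfBoundedRange f L (tendsto_pi_nhds.2 hf)
    (isBounded_iff_forall_norm_le.2 ⟨C, forall_mem_range.2 hL⟩), ?_, hf⟩
  exact ContinuousLinearMap.opNorm_le_bound _ ((norm_nonneg _).trans (hL 0)) fun x =>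
    le_of_tendsto (hf x).norm (Eventually.of_forall fun n => (L n).le_of_opNorm_le (hL n) x)

end NontriviallyNormed

theorem integral_norm_sq_le_of_eLpNorm_two_le {α E : Type*} [MeasurableSpace α] {μ : Measure α}
    [NormedAddCommGroup E] {f : α → E} (hf : MemLp f 2 μ) {b : ℝ} (hb : 0 ≤ b)
    (hle : eLpNorm f 2 μ ≤ ENNReal.ofReal b) : ∫ a, ‖f a‖ ^ 2 ∂μ ≤ b ^ 2 := by
  rw [hf.eLpNorm_eq_integral_rpow_norm two_ne_zero ENNReal.ofNat_ne_top,
    ENNReal.ofReal_le_ofReal_iff hb] at hle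
  simp only [ENNReal.toReal_ofNat, Real.rpow_ofNat] at hle
  rwa [← one_div, ← Real.sqrt_eq_rpow, Real.sqrt_le_left hb] at hle

/-- `N` is the bounded operator `g(A) P`, obtained as the strong limit of the operators `gₙ(A) P`
for the approximants `gₙ` of `g`. The composition with `P`, a resolvent or `T t`, is needed because
`g(A)` itself need not be bounded. -/
def IsCalcComp {X : Type*} [NormedAddCommGroup X] [NormedSpace ℂ X] (T : ℝ → X →L[ℂ] X)
    (g : ℂ → ℂ) (P N : X →L[ℂ] X) : Prop :=
  ∀ x, Tendsto (fun n => decayCalc T (yosidaApprox g n) (P x)) atTop (𝓝 (N x))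

namespace IsCalcComp

variable {X : Type*} [NormedAddCommGroup X] [NormedSpace ℂ X] {T : ℝ → X →L[ℂ] X} {M ω : ℝ}
  {g g₁ g₂ : ℂ → ℂ} {m m₁ m₂ : ℝ} {P N N' N₁ N₂ N₁₂ : X →L[ℂ] X}

theorem unique (h : IsCalcComp T g P N) (h' : IsCalcComp T g P N') : N = N' :=
  ContinuousLinearMap.ext fun x => tendsto_nhds_unique (h x) (h' x)

theorem congr (h : IsCalcComp T g₁ P N) (hg : ∀ s : ℂ, s.re < 0 → g₁ s = g₂ s) :
    IsCalcComp T g₂ P N := fun x => (h x).congr fun n => by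
  rw [decayCalc_congr T fun s hs => ?_]
  simp only [yosidaApprox, hg s hs]

theorem add (hT : IsStableSemigroup T M ω) (hg₁ : IsBoundedHolo g₁ m₁) (hg₂ : IsBoundedHolo g₂ m₂)
    (h₁ : IsCalcComp T g₁ P N₁) (h₂ : IsCalcComp T g₂ P N₂) :
    IsCalcComp T (fun s => g₁ s + g₂ s) P (N₁ + N₂) := fun x => by
  refine ((h₁ x).add (h₂ x)).congr fun n => ?_
  rw [← hT.decayCalc_add (hg₁.isDecaying_yosidaApprox n) (hg₂.isDecaying_yosidaApprox n)]
  congr 2 with s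
  simp only [yosidaApprox, mul_add]

theorem const_mul (hT : IsStableSemigroup T M ω) (hg : IsBoundedHolo g m)
    (h : IsCalcComp T g P N) (a : ℂ) : IsCalcComp T (fun s => a * g s) P (a • N) := fun x => by
  refine ((h x).const_smul a).congr fun n => ?_
  rw [← hT.decayCalc_const_mul (hg.isDecaying_yosidaApprox n)]
  congr 2 with s
  simp only [yosidaApprox, mul_left_comm a]

variable [CompleteSpace X]

theorem laplaceResolvent_comp (hT : IsStableSemigroup T M ω) (hg : IsBoundedHolo g m)
    (h : IsCalcComp T g P N) {a : ℂ} (ha : 0 < a.re) :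
    IsCalcComp T (fun s => (a - s)⁻¹ * g s) P (laplaceResolvent T a ∘L N) := fun x => by
  refine (((laplaceResolvent T a).continuous.tendsto _).comp (h x)).congr fun n => ?_
  have hdecay := hg.isDecaying_yosidaApprox n
  have hω : -ω < a.re := by linarith [hT.pos]
  calc laplaceResolvent T a (decayCalc T (yosidaApprox g n) (P x))
      = decayCalc T (yosidaApprox g n) (laplaceResolvent T a (P x)) :=
        (hT.map_phillipsOp_comm (integrable_expCut_cexp hω)
          (fun _ ht => hT.decayCalc_comm hdecay ht) _).symm
    _ = decayCalc T (fun s => (a - s)⁻¹ * yosidaApprox g n s) (P x) :=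
        hT.decayCalc_laplaceResolvent hdecay ha (hdecay.bounded_mul (isBoundedHolo_inv_sub ha)) _
    _ = decayCalc T (yosidaApprox (fun s => (a - s)⁻¹ * g s) n) (P x) := by
        congr 2 with s
        simp only [yosidaApprox, mul_left_comm (a - s)⁻¹]

theorem comm_laplaceResolvent (hT : IsStableSemigroup T M ω) (hg : IsBoundedHolo g m) {a : ℂ}
    (ha : -ω < a.re) (h : IsCalcComp T g (laplaceResolvent T a) N) (x : X) :
    N (laplaceResolvent T a x) = laplaceResolvent T a (N x) := by
  refine tendsto_nhds_unique (h _)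
    ((((laplaceResolvent T a).continuous.tendsto _).comp (h x)).congr fun n => ?_)
  exact (hT.map_phillipsOp_comm (integrable_expCut_cexp ha)
    (fun _ ht => hT.decayCalc_comm (hg.isDecaying_yosidaApprox n) ht) _).symm

theorem of_isDecaying (hT : IsStableSemigroup T M ω) {k : ℂ → ℂ} {C : ℝ} (hk : IsDecaying k C) :
    IsCalcComp T k (.id ℂ X) (decayCalc T k) := fun x =>
  hT.tendsto_decayCalc hk.isDecaying_yosidaApprox hk (fun s _ => tendsto_yosidaApprox k s) x

theorem laplaceResolvent_sq (hT : IsStableSemigroup T M ω) (hg : IsBoundedHolo g m) :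
    IsCalcComp T g (laplaceResolvent T 1 ∘L laplaceResolvent T 1)
      (decayCalc T (regularize g)) := fun x => by
  refine (of_isDecaying hT hg.isDecaying_regularize x).congr fun n => ?_
  have hdecay := hg.isDecaying_yosidaApprox n
  have hinv : IsBoundedHolo (fun s => (1 - s)⁻¹) _ := isBoundedHolo_inv_sub (a := 1) (by simp)
  rw [ContinuousLinearMap.comp_apply, hT.decayCalc_laplaceResolvent hdecay (by simp)
    (hdecay.bounded_mul hinv), hT.decayCalc_laplaceResolvent (hdecay.bounded_mul hinv) (by simp)
    ((hdecay.bounded_mul hinv).bounded_mul hinv)]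
  rw [ContinuousLinearMap.id_apply]
  congr 2 with s
  simp only [yosidaApprox, regularize]
  ring

theorem mul (hT : IsStableSemigroup T M ω) (hg₁ : IsBoundedHolo g₁ m₁)
    (hg₂ : IsBoundedHolo g₂ m₂) (h₁ : IsCalcComp T g₁ (laplaceResolvent T 1) N₁)
    (h₂ : IsCalcComp T g₂ (laplaceResolvent T 1) N₂)
    (h₁₂ : IsCalcComp T (fun s => g₁ s * g₂ s) (laplaceResolvent T 1) N₁₂) (x : X) :
    N₁₂ (laplaceResolvent T 1 x) = N₁ (N₂ x) := by
  have hg₁₂ := hg₁.mul hg₂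
  have hdecay₂ : laplaceResolvent T 1 (N₂ x) = decayCalc T (regularize g₂) x := by
    rw [← h₂.comm_laplaceResolvent hT hg₂ (by linarith [hT.pos, Complex.one_re])]
    exact tendsto_nhds_unique (h₂ _) (laplaceResolvent_sq hT hg₂ x)
  refine (tendsto_nhds_unique (h₁₂ _) (laplaceResolvent_sq hT hg₁₂ x)).trans
    (tendsto_nhds_unique ((of_isDecaying hT hg₁₂.isDecaying_regularize x).congr fun n => ?_)
      (h₁ (N₂ x)))
  rw [hdecay₂, hT.decayCalc_mul (hg₁.isDecaying_yosidaApprox n) hg₂.isDecaying_regularize]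
  congr 2 with s
  simp only [yosidaApprox, regularize]
  ring

end IsCalcComp

namespace IsStableSemigroup

variable {X : Type*} [NormedAddCommGroup X] [NormedSpace ℂ X] {T : ℝ → X →L[ℂ] X}
  {M ω B : ℝ} {A : X →ₗ.[ℂ] X} {g : ℂ → ℂ} {m C : ℝ} {P : X →L[ℂ] X}

theorem memLp_two_and_integral_le (hT : IsStableSemigroup T M ω) (hB : IsOrbitBound T B)
    (hg : IsBoundedHolo g m) {S : ℝ → X →L[ℂ] X} (hS : ∀ t, 0 < t → IsCalcComp T g (T t) (S t))
    (x : X) : MemLp (fun t => S t x) 2 (volume.restrict (Ioi 0)) ∧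
      ∫ t in Ioi (0 : ℝ), ‖S t x‖ ^ 2 ≤ (B * m * ‖x‖) ^ 2 := by
  have hmeas : ∀ n, AEStronglyMeasurable (fun t => decayCalc T (yosidaApprox g n) (T t x))
      (volume.restrict (Ioi 0)) := fun n =>
    (decayCalc T (yosidaApprox g n)).continuous.comp_aestronglyMeasurable
      (hT.aestronglyMeasurable x)
  have hlim : ∀ᵐ t ∂volume.restrict (Ioi (0 : ℝ)),
      Tendsto (fun n => decayCalc T (yosidaApprox g n) (T t x)) atTop (𝓝 (S t x)) :=
    (ae_restrict_mem measurableSet_Ioi).mono fun t ht => hS t ht x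
  have hle : eLpNorm (fun t => S t x) 2 (volume.restrict (Ioi 0)) ≤ ENNReal.ofReal (B * m * ‖x‖) :=
    Lp.eLpNorm_le_of_ae_tendsto (Eventually.of_forall fun n =>
      hB.eLpNorm_le (hg.isDecaying_yosidaApprox n) (hg.isBoundedHolo_yosidaApprox n).norm_le x)
      hmeas hlim
  have hmem : MemLp (fun t => S t x) 2 (volume.restrict (Ioi 0)) :=
    ⟨aestronglyMeasurable_of_tendsto_ae atTop hmeas hlim, hle.trans_lt ENNReal.ofReal_lt_top⟩
  exact ⟨hmem, integral_norm_sq_le_of_eLpNorm_two_le hmem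
    (mul_nonneg (mul_nonneg hB.nonneg hg.nonneg) (norm_nonneg x)) hle⟩

variable [CompleteSpace X]

theorem exists_isCalcComp (hT : IsStableSemigroup T M ω) (hA : IsGenerator A T)
    (hg : IsBoundedHolo g m) (hP : ∀ x, laplaceResolvent T 1 (P x) = P (laplaceResolvent T 1 x))
    (hC : 0 ≤ C) (hle : ∀ n x, ‖decayCalc T (yosidaApprox g n) (P x)‖ ≤ C * ‖x‖) :
    ∃ N : X →L[ℂ] X, ‖N‖ ≤ C ∧ IsCalcComp T g P N := by
  have hR := hT.denseRange_laplaceResolvent hA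
    (show -ω < (1 : ℂ).re by linarith [hT.pos, Complex.one_re])
  refine exists_tendsto_apply_of_denseRange (L := fun n => decayCalc T (yosidaApprox g n) ∘L P)
    (fun n => ContinuousLinearMap.opNorm_le_bound _ hC (hle n))
    (hR.comp hR (laplaceResolvent T 1).continuous) fun y => ?_
  refine ((IsCalcComp.laplaceResolvent_sq hT hg (P y)).congr fun n => ?_).cauchySeq
  simp only [ContinuousLinearMap.comp_apply, Function.comp_apply, hP]

theorem norm_decayCalc_yosidaApprox_le (hT : IsStableSemigroup T M ω) (hB : IsOrbitBound T B)
    (hg : IsBoundedHolo g m) (n : ℕ) {t : ℝ} (ht : 0 < t) (x : X) :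
    ‖decayCalc T (yosidaApprox g n) (T t x)‖ ≤ M * (B * m * ‖x‖) / √t :=
  hT.norm_map_apply_le_of_eLpNorm_le
    (fun _ hs => hT.decayCalc_comm (hg.isDecaying_yosidaApprox n) hs)
    (mul_nonneg (mul_nonneg hB.nonneg hg.nonneg) (norm_nonneg x))
    (hB.eLpNorm_le (hg.isDecaying_yosidaApprox n) (hg.isBoundedHolo_yosidaApprox n).norm_le x) ht

theorem exists_isCalcComp_apply (hT : IsStableSemigroup T M ω) (hA : IsGenerator A T)
    (hB : IsOrbitBound T B) (hg : IsBoundedHolo g m) {t : ℝ} (ht : 0 < t) :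
    ∃ N : X →L[ℂ] X, ‖N‖ ≤ M * B * m / √t ∧ IsCalcComp T g (T t) N := by
  have hC : 0 ≤ M * B * m := mul_nonneg (mul_nonneg hT.nonneg hB.nonneg) hg.nonneg
  refine hT.exists_isCalcComp hA hg
    (hT.laplaceResolvent_comm (by linarith [hT.pos, Complex.one_re]) ht.le)
    (div_nonneg hC (Real.sqrt_nonneg t)) fun n x => ?_
  exact (hT.norm_decayCalc_yosidaApprox_le hB hg n ht x).trans_eq (by ring)

theorem exists_isCalcComp_laplaceResolvent (hT : IsStableSemigroup T M ω) (hA : IsGenerator A T)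
    (hB : IsOrbitBound T B) (hg : IsBoundedHolo g m) :
    ∃ N : X →L[ℂ] X, IsCalcComp T g (laplaceResolvent T 1) N := by
  have hC : 0 ≤ M * B * m := mul_nonneg (mul_nonneg hT.nonneg hB.nonneg) hg.nonneg
  obtain ⟨N, -, hN⟩ := hT.exists_isCalcComp (P := laplaceResolvent T 1) hA hg (fun _ => rfl)
    (mul_nonneg hC (Real.Gamma_nonneg_of_nonneg one_half_pos.le)) fun n x =>
      (hT.norm_map_laplaceResolvent_le fun t ht =>
        hT.norm_decayCalc_yosidaApprox_le hB hg n ht x).trans_eq (by ring)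
  exact ⟨N, hN⟩

end IsStableSemigroup

theorem isBoundedHolo_one : IsBoundedHolo (fun _ => 1) 1 :=
  ⟨differentiableOn_const 1, fun _ _ => norm_one.le⟩

theorem IsCalcComp.eq_laplaceResolvent_of_one {X : Type*} [NormedAddCommGroup X]
    [InnerProductSpace ℂ X] [CompleteSpace X] {T : ℝ → X →L[ℂ] X} {M ω : ℝ}
    (hT : IsStableSemigroup T M ω) {N : X →L[ℂ] X}
    (hN : IsCalcComp T (fun _ => 1) (laplaceResolvent T 1) N) : N = laplaceResolvent T 1 := by
  ext x
  have hlimit : ∀ t : ℝ, 0 < t → Tendsto (fun n => decayCalc T (yosidaApprox (fun _ => 1) n)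
      (T t (laplaceResolvent T 1 x))) atTop (𝓝 (N (T t x))) := fun t ht => by
    rw [← hT.laplaceResolvent_comm (by linarith [hT.pos, Complex.one_re]) ht.le]
    exact hN (T t x)
  have hcont : ∀ z, ContinuousOn (fun t => T t z) (Ioi 0) := fun z =>
    (hT.continuousOn z).mono Ioi_subset_Ici_self
  have heq : EqOn (fun t => N (T t x)) (fun t => T t (laplaceResolvent T 1 x)) (Ioi 0) :=
    Measure.eqOn_open_of_ae_eq
      (hT.isToeplitzImage (b := fun _ => 1) isBoundedHolo_one
        (Eventually.of_forall fun _ => tendsto_const_nhds) hlimit).ae_eq_of_one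
      isOpen_Ioi (N.continuous.comp_continuousOn (hcont x)) (hcont _)
  have hzero : ∀ z, Tendsto (fun t => T t z) (𝓝[>] 0) (𝓝 z) := fun z => by
    simpa only [hT.map_zero, ContinuousLinearMap.id_apply] using
      ((hT.continuousOn z) 0 self_mem_Ici).mono_left (nhdsWithin_mono 0 Ioi_subset_Ici_self)
  exact tendsto_nhds_unique ((N.continuous.tendsto _).comp (hzero x))
    ((hzero _).congr' (heq.symm.eventuallyEq_of_mem self_mem_nhdsWithin))

end StrongLimits

section HInfMinus

/-- The extension of `g` by zero to the whole plane, which turns an element of `HInfMinus` into a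
function satisfying `IsBoundedHolo`. -/
noncomputable def hInfExtend (g : HInfMinus) (s : ℂ) : ℂ :=
  open Classical in if h : s ∈ leftHalfPlane then g.1 ⟨s, h⟩ else 0

theorem hInfExtend_of_neg (g : HInfMinus) {s : ℂ} (h : s.re < 0) : hInfExtend g s = g.1 ⟨s, h⟩ :=
  dif_pos h

theorem isBoundedHolo_hInfExtend (g : HInfMinus) : IsBoundedHolo (hInfExtend g) (hInfNorm g) := by
  obtain ⟨⟨G, hG, hgG⟩, C, hC⟩ := g.2
  refine ⟨hG.congr fun s hs => (hInfExtend_of_neg g hs).trans (hgG ⟨s, hs⟩), fun s hs => ?_⟩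
  rw [hInfExtend_of_neg g hs]
  exact le_ciSup (f := fun s : leftHalfPlane => ‖g.1 s‖) ⟨C, forall_mem_range.2 hC⟩ ⟨s, hs⟩

theorem IsBoundaryFunction.hasBoundarySymbol {g : HInfMinus} {b : ℝ → ℂ}
    (hb : IsBoundaryFunction g b) : HasBoundarySymbol (hInfExtend g) fun ξ => b (2 * π * ξ) := by
  filter_upwards [(Measure.quasiMeasurePreserving_smul volume Real.two_pi_pos.ne').ae hb]
    with ξ hξ
  let neg (c : Iio (0 : ℝ)) : Ioi (0 : ℝ) := ⟨-c, mem_Ioi.2 (neg_pos.2 c.2)⟩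
  have hneg : Tendsto neg (comap Subtype.val (𝓝 0)) (comap Subtype.val (𝓝 0)) :=
    tendsto_comap_iff.2 ((continuous_neg.tendsto' 0 0 neg_zero).comp tendsto_comap)
  rw [nhdsWithin, ← Subtype.range_coe (s := Iio (0 : ℝ)), ← Filter.map_comap, tendsto_map'_iff]
  refine (hξ.comp hneg).congr fun c => ?_
  rw [Function.comp_apply, Function.comp_apply,
    hInfExtend_of_neg g ((vertLine_re c ξ).trans_lt c.2)]
  simp [neg, vertLine]

end HInfMinus

section Calculus

variable {X : Type*} [NormedAddCommGroup X] [NormedSpace ℂ X] {A : X →ₗ.[ℂ] X}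

theorem IsResolventAt.apply_sub {R : X →L[ℂ] X} (hR : IsResolventAt A 1 R) (x : A.domain) :
    R ((x : X) - A x) = x := by
  simpa only [one_smul] using hR.2 x

/-- The linear map `g ↦ g(A) = N g ∘ (1 - A)` on `D(A)`, for a linear family of bounded operators
`N g`, which stand for `g(A) (1 - A)⁻¹`. -/
def calculusOfCompResolvent (A : X →ₗ.[ℂ] X) (N : HInfMinus →ₗ[ℂ] (X →L[ℂ] X)) :
    HInfMinus →ₗ[ℂ] (A.domain →ₗ[ℂ] X) :=
  (LinearMap.lcomp ℂ X (A.domain.subtype - A.toFun)) ∘ₗ (ContinuousLinearMap.coeLM ℂ) ∘ₗ N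

theorem calculusOfCompResolvent_apply (N : HInfMinus →ₗ[ℂ] (X →L[ℂ] X)) (g : HInfMinus)
    (x : A.domain) : calculusOfCompResolvent A N g x = N g ((x : X) - A x) := rfl

theorem isBoundedOnDomain_calculusOfCompResolvent (N : HInfMinus →ₗ[ℂ] (X →L[ℂ] X))
    (g : HInfMinus) : IsBoundedOnDomain (calculusOfCompResolvent A N g) :=
  ⟨‖N g‖, fun x => (N g).le_opNorm_of_le (norm_sub_le (x : X) (A x))⟩

theorem applyOnDomain_of_mem (C : A.domain →ₗ[ℂ] X) {x : X} (hx : x ∈ A.domain) :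
    applyOnDomain C x = C ⟨x, hx⟩ :=
  dif_pos hx

theorem isAdmissibleWith_of_eq {T S : ℝ → X →L[ℂ] X} {C : A.domain →ₗ[ℂ] X} {m : ℝ}
    (hS : ∀ t, 0 < t → ∀ x : A.domain, S t x = applyOnDomain C (T t x))
    (hL2 : ∀ x, MemLp (fun t => S t x) 2 (volume.restrict (Ioi 0)) ∧
      ∫ t in Ioi (0 : ℝ), ‖S t x‖ ^ 2 ≤ m * ‖x‖ ^ 2) : IsAdmissibleWith T C m := fun x => by
  refine ⟨(hL2 x).1.ae_eq ?_, (setIntegral_congr_fun measurableSet_Ioi fun t ht => ?_).trans_le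
    (hL2 x).2⟩
  · filter_upwards [ae_restrict_mem measurableSet_Ioi] with t ht using hS t ht x
  · simp only [hS t ht x]

variable {T : ℝ → X →L[ℂ] X} {M ω : ℝ} {N : HInfMinus →ₗ[ℂ] (X →L[ℂ] X)} [CompleteSpace X]

theorem IsStableSemigroup.isResolventAt_one (hT : IsStableSemigroup T M ω)
    (hA : IsGenerator A T) : IsResolventAt A 1 (laplaceResolvent T 1) :=
  hT.isResolventAt_laplaceResolvent hA (by linarith [hT.pos, Complex.one_re])

theorem IsCalcComp.apply_eq_applyOnDomain (hT : IsStableSemigroup T M ω) (hA : IsGenerator A T)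
    {g : HInfMinus} (hN : IsCalcComp T (hInfExtend g) (laplaceResolvent T 1) (N g)) {t : ℝ}
    (ht : 0 ≤ t) {S : X →L[ℂ] X} (hS : IsCalcComp T (hInfExtend g) (T t) S) (x : A.domain) :
    S x = applyOnDomain (calculusOfCompResolvent A N g) (T t x) := by
  have hmem := hA.apply_mem_domain hT.toIsC0Semigroup x.2 ht
  rw [applyOnDomain_of_mem _ hmem, calculusOfCompResolvent_apply]
  refine tendsto_nhds_unique (hS x) ((hN _).congr fun n => ?_)
  rw [(hT.isResolventAt_one hA).apply_sub ⟨T t x, hmem⟩]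

theorem calculusOfCompResolvent_mul (hT : IsStableSemigroup T M ω) (hA : IsGenerator A T)
    (hN : ∀ g, IsCalcComp T (hInfExtend g) (laplaceResolvent T 1) (N g)) (g₁ g₂ : HInfMinus)
    (x : A.domain) (hx : A x ∈ A.domain) : ∃ h : calculusOfCompResolvent A N g₂ x ∈ A.domain,
      calculusOfCompResolvent A N (g₁ * g₂) x =
        calculusOfCompResolvent A N g₁ ⟨calculusOfCompResolvent A N g₂ x, h⟩ := by
  have hR := hT.isResolventAt_one hA
  have hg := isBoundedHolo_hInfExtend
  let z : A.domain := ⟨x - A x, A.domain.sub_mem x.2 hx⟩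
  obtain ⟨hmem, hsub⟩ := hR.1 (N g₂ (z - A z))
  have hval : calculusOfCompResolvent A N g₂ x = laplaceResolvent T 1 (N g₂ (z - A z)) := by
    rw [calculusOfCompResolvent_apply,
      ← (hN g₂).comm_laplaceResolvent hT (hg g₂) (by linarith [hT.pos, Complex.one_re]),
      hR.apply_sub z]
  have hmul : N (g₁ * g₂) z = N g₁ (N g₂ (z - A z)) := by
    refine (congrArg (N (g₁ * g₂)) (hR.apply_sub z)).symm.trans ?_
    refine (hN g₁).mul hT (hg g₁) (hg g₂) (hN g₂) ((hN (g₁ * g₂)).congr fun s hs => ?_) _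
    simp only [hInfExtend_of_neg _ hs, MulMemClass.coe_mul, Pi.mul_apply]
  simp only [hval]
  refine ⟨hmem, hmul.trans ?_⟩
  rw [calculusOfCompResolvent_apply]
  congr 1
  simpa only [one_smul] using hsub.symm

end Calculus

section Main

variable {X : Type*} [NormedAddCommGroup X] [InnerProductSpace ℂ X] [CompleteSpace X]
  {A : X →ₗ.[ℂ] X} {T : ℝ → X →L[ℂ] X} {M ω B : ℝ} {N : HInfMinus →ₗ[ℂ] (X →L[ℂ] X)}

theorem IsStableSemigroup.exists_linearMap_isCalcComp (hT : IsStableSemigroup T M ω)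
    (hA : IsGenerator A T) (hB : IsOrbitBound T B) : ∃ N : HInfMinus →ₗ[ℂ] (X →L[ℂ] X),
      ∀ g, IsCalcComp T (hInfExtend g) (laplaceResolvent T 1) (N g) := by
  have hg := isBoundedHolo_hInfExtend
  choose N hN using fun g => hT.exists_isCalcComp_laplaceResolvent hA hB (hg g)
  refine ⟨{ toFun := N, map_add' := fun g₁ g₂ => ?_, map_smul' := fun a g => ?_ }, hN⟩
  · refine (hN _).unique (((hN g₁).add hT (hg g₁) (hg g₂) (hN g₂)).congr fun s hs => ?_)
    simp only [hInfExtend_of_neg _ hs, AddMemClass.coe_add, Pi.add_apply]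
  · refine (hN _).unique (((hN g).const_mul hT (hg g) a).congr fun s hs => ?_)
    simp only [hInfExtend_of_neg _ hs, SetLike.val_smul, Pi.smul_apply, smul_eq_mul]

theorem calculusOfCompResolvent_one (hT : IsStableSemigroup T M ω) (hA : IsGenerator A T)
    (hN : IsCalcComp T (hInfExtend 1) (laplaceResolvent T 1) (N 1)) (x : A.domain) :
    calculusOfCompResolvent A N 1 x = x := by
  have hone : N 1 = laplaceResolvent T 1 :=
    (hN.congr fun s hs => hInfExtend_of_neg 1 hs).eq_laplaceResolvent_of_one hT
  rw [calculusOfCompResolvent_apply, hone, (hT.isResolventAt_one hA).apply_sub]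

theorem calculusOfCompResolvent_invSubFun (hT : IsStableSemigroup T M ω) (hA : IsGenerator A T)
    (hN : ∀ g, IsCalcComp T (hInfExtend g) (laplaceResolvent T 1) (N g)) {a : ℂ} (ha : 0 < a.re)
    (x : A.domain) :
    calculusOfCompResolvent A N (invSubFun a ha) x = laplaceResolvent T a x := by
  have hcomp : N (invSubFun a ha) = laplaceResolvent T a ∘L N 1 :=
    (hN _).unique (((hN 1).laplaceResolvent_comp hT (isBoundedHolo_hInfExtend 1) ha).congr
      fun s hs => by
        simp only [hInfExtend_of_neg _ hs]
        exact mul_one _)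
  rw [calculusOfCompResolvent_apply, hcomp, ContinuousLinearMap.comp_apply,
    ← calculusOfCompResolvent_apply, calculusOfCompResolvent_one hT hA (hN 1)]

theorem isHInfCalculus_calculusOfCompResolvent (hT : IsStableSemigroup T M ω)
    (hA : IsGenerator A T)
    (hN : ∀ g, IsCalcComp T (hInfExtend g) (laplaceResolvent T 1) (N g)) :
    IsHInfCalculus A (calculusOfCompResolvent A N) where
  map_one := calculusOfCompResolvent_one hT hA (hN 1)
  map_resolvent a ha := ⟨laplaceResolvent T a,
    hT.isResolventAt_laplaceResolvent hA (by linarith [hT.pos]),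
    calculusOfCompResolvent_invSubFun hT hA hN ha⟩
  map_mul := calculusOfCompResolvent_mul hT hA hN

end Main

theorem theorem1_general {X : Type*} [NormedAddCommGroup X] [InnerProductSpace ℂ X]
    [CompleteSpace X] (A : X →ₗ.[ℂ] X) (T : ℝ → X →L[ℂ] X)
    (hT : IsC0Semigroup T) (hA : IsGenerator A T) (hstable : IsExponentiallyStable T) :
    ∃ (Φ : HInfMinus →ₗ[ℂ] (A.domain →ₗ[ℂ] X)) (γA γ : ℝ),
      IsHInfCalculus A Φ ∧
      ∀ g : HInfMinus,
        IsBoundedOnDomain (Φ g) ∧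
        IsAdmissibleWith T (Φ g) (γA * hInfNorm g ^ 2) ∧
        ∃ S : ℝ → X →L[ℂ] X,
          (∀ t : ℝ, 0 < t →
            (∀ x : A.domain, S t x = applyOnDomain (Φ g) (T t x)) ∧
            ‖S t‖ ≤ γ * hInfNorm g / Real.sqrt t) ∧
          (∀ x : X,
            MemLp (fun t : ℝ => S t x) 2 (volume.restrict (Set.Ioi (0 : ℝ))) ∧
            ∫ t in Set.Ioi (0 : ℝ), ‖S t x‖ ^ 2 ≤ γA * hInfNorm g ^ 2 * ‖x‖ ^ 2) ∧
          ∀ b : ℝ → ℂ, IsBoundaryFunction g b → ∀ x : X,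
            IsToeplitzImage b (fun t => T t x) (fun t => S t x) := by
  obtain ⟨M, ω, hTs⟩ := hstable.exists_isStableSemigroup hT
  obtain ⟨B, hB⟩ := hTs.exists_isOrbitBound
  obtain ⟨N, hN⟩ := hTs.exists_linearMap_isCalcComp hA hB
  refine ⟨calculusOfCompResolvent A N, B ^ 2, M * B,
    isHInfCalculus_calculusOfCompResolvent hTs hA hN, fun g => ?_⟩
  have hg := isBoundedHolo_hInfExtend g
  choose! S hSnorm hS using fun t (ht : 0 < t) => hTs.exists_isCalcComp_apply hA hB hg ht
  have hdomain : ∀ t, 0 < t → ∀ x : A.domain,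
      S t x = applyOnDomain (calculusOfCompResolvent A N g) (T t x) := fun t ht =>
    (hN g).apply_eq_applyOnDomain hTs hA ht.le (hS t ht)
  have hL2 : ∀ x, MemLp (fun t => S t x) 2 (volume.restrict (Ioi 0)) ∧
      ∫ t in Ioi (0 : ℝ), ‖S t x‖ ^ 2 ≤ B ^ 2 * hInfNorm g ^ 2 * ‖x‖ ^ 2 := fun x => by
    simpa only [mul_pow] using hTs.memLp_two_and_integral_le hB hg hS x
  exact ⟨isBoundedOnDomain_calculusOfCompResolvent N g, isAdmissibleWith_of_eq hdomain hL2, S,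
    fun t ht => ⟨hdomain t ht, hSnorm t ht⟩, hL2, fun b hb x =>
      hTs.isToeplitzImage hg hb.hasBoundarySymbol fun t ht => hS t ht x⟩

theorem theorem1 {X : Type*} [NormedAddCommGroup X] [InnerProductSpace ℂ X] [CompleteSpace X]
    [TopologicalSpace.SeparableSpace X]
    (A : X →ₗ.[ℂ] X) (T : ℝ → X →L[ℂ] X)
    (hT : IsC0Semigroup T) (hA : IsGenerator A T) (hstable : IsExponentiallyStable T) :
    ∃ (Φ : HInfMinus →ₗ[ℂ] (A.domain →ₗ[ℂ] X)) (γA γ : ℝ),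
      IsHInfCalculus A Φ ∧
      ∀ g : HInfMinus,
        IsBoundedOnDomain (Φ g) ∧
        IsAdmissibleWith T (Φ g) (γA * hInfNorm g ^ 2) ∧
        ∃ S : ℝ → X →L[ℂ] X,
          (∀ t : ℝ, 0 < t →
            (∀ x : A.domain, S t x = applyOnDomain (Φ g) (T t x)) ∧
            ‖S t‖ ≤ γ * hInfNorm g / Real.sqrt t) ∧
          (∀ x : X,
            MemLp (fun t : ℝ => S t x) 2 (volume.restrict (Set.Ioi (0 : ℝ))) ∧
            ∫ t in Set.Ioi (0 : ℝ), ‖S t x‖ ^ 2 ≤ γA * hInfNorm g ^ 2 * ‖x‖ ^ 2) ∧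
          ∀ b : ℝ → ℂ, IsBoundaryFunction g b → ∀ x : X,
            IsToeplitzImage b (fun t => T t x) (fun t => S t x) :=
  theorem1_general A T hT hA hstable
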